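/- Let $(\mathcal A,\tau)$ be a tracial $W^*$-probability space (a $W^*$-algebra with a normal tracial state) with pairwise orthogonal projections $p_1,\dots,p_k$, $\tau(p_i)\neq 0$, adding up to $1$ (a $(p_1,\dots,p_k)$-rectangular probability space). Let $\mathcal D=\langle p_1,\dots,p_k\rangle$ and let $\mathbf F:\mathcal A\to\mathcal D$, $\mathbf F(a)=\sum_{i}p_i\,\tau(p_i)^{-1}\tau(p_ia)$, be the $\tau$-preserving conditional expectation. Write $\mathcal A^{(i,j)}=\{a\in\mathcal A: a=p_iap_j\}$; the elements of $\bigcup_{i,j}\mathcal A^{(i,j)}$ are called simple. Let $c_1,\dots,c_s$ and $d_1,\dots,d_t$ be simple elements such that the algebras $\langle c_1,\dots,c_s,\mathcal D\rangle$ and $\langle d_1,\dots,d_t,\mathcal D\rangle$ are free with amalgamation over $\mathcal D$. Let $n\ge 1$, $r,r':[n]\to[k]$, and for $1\le j\le n$ let $D_j\in\mathcal A^{(r(j),r'(j))}$ be a product of $d_i$'s and $C_j\in\mathcal A^{(r'(j),r(j+1))}$ a product of $c_i$'s, indices being taken modulo $n$. Let $NC(n)$ be the lattice of non-crossing partitions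 of $[n]$, ordered by $\sigma\le\pi$ iff every block of $\sigma$ is contained in a block of $\pi$, with Möbius function $\mu_n$. For $\pi\in NC(n)$ let $K(\pi)$ be its Kreweras complement, the largest partition in $NC(\overline 1,\dots,\overline n)\cong NC(n)$ such that $\pi\cup K(\pi)$ is a non-crossing partition of $1<\overline 1<\dots<n<\overline n$. Regard a partition $\pi$ also as the permutation of $[n]$ whose cycles are the blocks of $\pi$ in increasing order, and put $\tau_\pi[a_1,\dots,a_n]=\prod_{\{i_1<\dots<i_l\}\in\pi}\tau(a_{i_1}\cdots a_{i_l})$. Let $NC(n)_{r,r'}$ be the set of pairs $\sigma\le\pi$ in $NC(n)$ with $$r'(i)=r(\sigma(i)),\qquad r(i)=r'(K(\pi)(i-1)),\qquad 1\le i\le n,$$ and for such pairs let $$\omega(\sigma,\pi)_{r,r'}=\Bigg(\prod_{\substack{i\in[n]\\ \sigma(i)\le i}}\tau(p_{r'(i)})^{-1}\Bigg)\Bigg(\prod_{\substack{j\in[n-1]\\ K(\pi)(j)\le j}}\tau(p_{r(j+1)})^{-1}\Bigg).$$ Then $$\mathbf F(D_1C_1\cdots D_nC_n)=\frac{p_{r(1)}}{\tau(p_{r(1)})}\sum_{(\sigma,\pi)\in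 NC(n)_{r,r'}}\omega(\sigma,\pi)_{r,r'}\;\tau_{\sigma}[D_1,\dots,D_n]\;\tau_{K(\pi)}[C_1,\dots,C_n]\;\mu_n[\sigma,\pi].$$ -/

import Mathlib

open scoped ComplexOrder

namespace RectangularProbability

/-! ### Operator-valued probability and freeness with amalgamation -/

section Amalgamation

variable {A : Type*} [Ring A] [Algebra ℂ A]

/-- `F : A → B ⊆ A` is a conditional expectation of `A` onto the subalgebra `B`. -/
structure IsConditionalExpectation (B : Subalgebra ℂ A) (F : A →ₗ[ℂ] A) : Prop where
  mem : ∀ a, F a ∈ B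
  map_bimodule : ∀ b ∈ B, ∀ b' ∈ B, ∀ a, F (b * a * b') = b * F a * b'
  map_one : F 1 = 1

/-- The subalgebras `𝒜 i ⊇ B` are free with amalgamation over `B`: every nonempty alternating
product of `F`-centred elements is `F`-centred. The factors are indexed by `Fin (m + 1)`. -/
def IsFreeOver (B : Subalgebra ℂ A) (F : A →ₗ[ℂ] A) {ι : Type*} (𝒜 : ι → Subalgebra ℂ A) : Prop :=
  (∀ i, B ≤ 𝒜 i) ∧
    ∀ (m : ℕ) (ε : Fin (m + 1) → ι) (a : Fin (m + 1) → A),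
      (∀ j, a j ∈ 𝒜 (ε j)) → (∀ j, F (a j) = 0) →
      (∀ j : Fin m, ε j.castSucc ≠ ε j.succ) →
      F (List.ofFn a).prod = 0

end Amalgamation

/-! ### Rectangular probability spaces -/

section Rectangular

/-- A `(p₁, …, p_k)`-rectangular probability space on the W*-algebra `A`: a normal tracial state `τ`
together with pairwise orthogonal projections `p i` of nonzero trace adding up to one. -/
structure RectangularSpace (A : Type*) [CStarAlgebra A] [PartialOrder A] [StarOrderedRing A]
    [WStarAlgebra A] (k : ℕ) where
  /-- the tracial state -/
  τ : A →ₗ[ℂ] ℂ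
  τ_nonneg : ∀ a, 0 ≤ τ (star a * a)
  τ_one : τ 1 = 1
  τ_comm : ∀ a b, τ (a * b) = τ (b * a)
  /-- normality: suprema of bounded increasing nets are preserved -/
  τ_normal : ScottContinuous fun a => (τ a).re
  /-- the projections -/
  p : Fin k → A
  p_proj : ∀ i, IsStarProjection (p i)
  p_orthogonal : ∀ i j, i ≠ j → p i * p j = 0
  p_sum : ∑ i, p i = 1
  τ_p_ne_zero : ∀ i, τ (p i) ≠ 0

namespace RectangularSpace

variable {A : Type*} [CStarAlgebra A] [PartialOrder A] [StarOrderedRing A] [WStarAlgebra A] {k : ℕ}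

/-- The algebra `𝒟` generated by the projections. It is the linear span of the `p i`
(see `mem_diag_iff`), hence finite-dimensional and equal to the W*-algebra they generate. -/
def diag (X : RectangularSpace A k) : Subalgebra ℂ A :=
  Algebra.adjoin ℂ (Set.range X.p)

/-- The `τ`-preserving conditional expectation onto `𝒟`,
`F(a) = ∑ i, p i τ(p i)⁻¹ τ(p i a)` (see `expect_isConditionalExpectation`, `τ_expect` and
`expect_unique`). -/
noncomputable def expect (X : RectangularSpace A k) : A →ₗ[ℂ] A where
  toFun a := ∑ i, ((X.τ (X.p i))⁻¹ * X.τ (X.p i * a)) • X.p i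
  map_add' a b := by
    simp only [mul_add, map_add, add_smul, Finset.sum_add_distrib]
  map_smul' z a := by
    simp only [mul_smul_comm, map_smul, smul_eq_mul, RingHom.id_apply, Finset.smul_sum, smul_smul,
      mul_left_comm]

/-- `a ∈ A^{(i,j)}`, i.e. `a = p i a p j`. -/
def IsCorner (X : RectangularSpace A k) (i j : Fin k) (a : A) : Prop :=
  a = X.p i * a * X.p j

/-- Simple elements are the elements of `⋃ i j, A^{(i,j)}`. -/
def IsSimple (X : RectangularSpace A k) (a : A) : Prop :=
  ∃ i j, X.IsCorner i j a

/-- The subalgebra `⟨s, 𝒟⟩` generated by `s` and `𝒟`. -/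
def algebraGenerated (X : RectangularSpace A k) (s : Set A) : Subalgebra ℂ A :=
  Algebra.adjoin ℂ (s ∪ Set.range X.p)

theorem p_mul_p (X : RectangularSpace A k) (i j : Fin k) :
    X.p i * X.p j = if i = j then X.p i else 0 := by
  split_ifs with h
  · subst h; exact (X.p_proj i).isIdempotentElem
  · exact X.p_orthogonal i j h

theorem mem_diag_iff (X : RectangularSpace A k) (b : A) :
    b ∈ X.diag ↔ ∃ l : Fin k → ℂ, b = ∑ i, l i • X.p i := by
  constructor
  · intro hb
    induction hb using Algebra.adjoin_induction with
    | mem x hx =>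
      obtain ⟨i, rfl⟩ := hx
      exact ⟨fun j => if j = i then 1 else 0, by simp⟩
    | algebraMap z =>
      exact ⟨fun _ => z, by rw [← Finset.smul_sum, X.p_sum, Algebra.algebraMap_eq_smul_one]⟩
    | add x y _ _ hx hy =>
      obtain ⟨l, rfl⟩ := hx
      obtain ⟨m, rfl⟩ := hy
      exact ⟨fun i => l i + m i, by simp [add_smul, Finset.sum_add_distrib]⟩
    | mul x y _ _ hx hy =>
      obtain ⟨l, rfl⟩ := hx
      obtain ⟨m, rfl⟩ := hy
      exact ⟨fun i => l i * m i, by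
        simp [Finset.sum_mul, Finset.mul_sum, p_mul_p, smul_smul, mul_comm]⟩
  · rintro ⟨l, rfl⟩
    exact sum_mem fun i _ => Subalgebra.smul_mem _ (Algebra.subset_adjoin (Set.mem_range_self i)) _

theorem expect_isConditionalExpectation (X : RectangularSpace A k) :
    IsConditionalExpectation X.diag X.expect where
  mem a := (X.mem_diag_iff _).2 ⟨fun i => (X.τ (X.p i))⁻¹ * X.τ (X.p i * a), rfl⟩
  map_bimodule b hb b' hb' a := by
    obtain ⟨l, rfl⟩ := (X.mem_diag_iff _).1 hb
    obtain ⟨m, rfl⟩ := (X.mem_diag_iff _).1 hb'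
    have key : ∀ i, X.τ (X.p i * ((∑ j, l j • X.p j) * a * ∑ j, m j • X.p j))
        = l i * m i * X.τ (X.p i * a) := by
      intro i
      have h1 : X.p i * (∑ j, l j • X.p j) = l i • X.p i := by
        simp [Finset.mul_sum, p_mul_p]
      have h2 : (∑ j, m j • X.p j) * X.p i = m i • X.p i := by
        simp [Finset.sum_mul, p_mul_p]
      rw [← mul_assoc, ← mul_assoc, h1, X.τ_comm, smul_mul_assoc, mul_smul_comm, ← mul_assoc, h2,
        map_smul, smul_mul_assoc, map_smul, smul_eq_mul, smul_eq_mul, mul_assoc]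
    show ∑ i, ((X.τ (X.p i))⁻¹ * X.τ (X.p i * (_ * a * _))) • X.p i
      = _ * (∑ i, ((X.τ (X.p i))⁻¹ * X.τ (X.p i * a)) • X.p i) * _
    simp only [key]
    simp only [Finset.sum_mul, Finset.mul_sum, smul_mul_assoc, mul_smul_comm, p_mul_p, smul_smul,
      smul_ite, smul_zero, Finset.sum_ite_eq', Finset.mem_univ, if_true]
    refine Finset.sum_congr rfl fun i _ => ?_
    congr 1
    ring
  map_one := by
    show ∑ i, ((X.τ (X.p i))⁻¹ * X.τ (X.p i * 1)) • X.p i = 1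
    simp [X.τ_p_ne_zero, X.p_sum]

theorem τ_expect (X : RectangularSpace A k) (a : A) : X.τ (X.expect a) = X.τ a := by
  show X.τ (∑ i, ((X.τ (X.p i))⁻¹ * X.τ (X.p i * a)) • X.p i) = X.τ a
  have h : ∀ i, (X.τ (X.p i))⁻¹ * X.τ (X.p i * a) * X.τ (X.p i) = X.τ (X.p i * a) := by
    intro i
    field_simp [X.τ_p_ne_zero i]
  simp only [map_sum, map_smul, smul_eq_mul, h]
  rw [← map_sum, ← Finset.sum_mul, X.p_sum, one_mul]

theorem expect_unique (X : RectangularSpace A k) (F : A →ₗ[ℂ] A)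
    (hF : IsConditionalExpectation X.diag F) (hτ : ∀ a, X.τ (F a) = X.τ a) : F = X.expect := by
  ext a
  obtain ⟨l, hl⟩ := (X.mem_diag_iff _).1 (hF.mem a)
  have key : ∀ i, X.τ (X.p i * a) = l i * X.τ (X.p i) := by
    intro i
    have h := hF.map_bimodule (X.p i) (Algebra.subset_adjoin ⟨i, rfl⟩) 1 (one_mem _) a
    rw [mul_one, mul_one] at h
    rw [← hτ, h, hl]
    simp [Finset.mul_sum, p_mul_p]
  show F a = ∑ i, ((X.τ (X.p i))⁻¹ * X.τ (X.p i * a)) • X.p i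
  rw [hl]
  refine Finset.sum_congr rfl fun i _ => ?_
  rw [key, mul_comm (l i), inv_mul_cancel_left₀ (X.τ_p_ne_zero i)]

end RectangularSpace

end Rectangular

/-! ### Non-crossing partitions -/

section NonCrossing

/-- A family of blocks in a totally ordered set is non-crossing. -/
def IsNonCrossing {S : Type*} [LinearOrder S] (P : Finset (Finset S)) : Prop :=
  ∀ V ∈ P, ∀ W ∈ P, ∀ a ∈ V, ∀ b ∈ W, ∀ c ∈ V, ∀ d ∈ W, a < b → b < c → c < d → V = W

/-- `NC(n)`, the non-crossing partitions of `Fin n = {0, …, n - 1}`. The order inherited from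
`Finpartition` is `σ ≤ π` iff every block of `σ` is contained in a block of `π`. -/
abbrev NC (n : ℕ) : Type :=
  {π : Finpartition (Finset.univ : Finset (Fin n)) // IsNonCrossing π.parts}

open Classical in
/-- The Möbius function `μ_n[σ, π]` of the poset `NC(n)`. -/
noncomputable def ncMu {n : ℕ} (σ π : NC n) : ℂ :=
  letI : LocallyFiniteOrder (NC n) := Fintype.toLocallyFiniteOrder
  IncidenceAlgebra.mu ℂ σ π

/-- The blocks of the partition `π ∪ κ` of `1 < 1̄ < 2 < 2̄ < ⋯ < n < n̄`, where `π` sits on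
the unbarred points `(i, false)` and `κ` on the barred points `(i, true)` (lexicographic order). -/
def interleave {n : ℕ} (π κ : Finpartition (Finset.univ : Finset (Fin n))) :
    Finset (Finset (Fin n ×ₗ Bool)) :=
  π.parts.image (fun V => V.image fun i => toLex (i, false)) ∪
    κ.parts.image (fun V => V.image fun i => toLex (i, true))

/-- Two barred points are related if no block of `π` is separated by them. -/
def complSetoid {n : ℕ} (π : Finpartition (Finset.univ : Finset (Fin n))) : Setoid (Fin n) where
  r i j := ∀ V ∈ π.parts, ∀ a ∈ V, ∀ b ∈ V, ((a ≤ i ↔ a ≤ j) ↔ (b ≤ i ↔ b ≤ j))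
  iseqv := ⟨fun _ _ _ _ _ _ _ => by tauto, fun h V hV a ha b hb => by
    have := h V hV a ha b hb; tauto, fun h h' V hV a ha b hb => by
    have := h V hV a ha b hb; have := h' V hV a ha b hb; tauto⟩

theorem rel_of_mem_parts {n : ℕ} (s : Setoid (Fin n)) [DecidableRel s.r] {V : Finset (Fin n)}
    (hV : V ∈ (Finpartition.ofSetoid s).parts) {a b : Fin n} (ha : a ∈ V) (hb : b ∈ V) : s a b := by
  rw [← Finpartition.mem_part_ofSetoid_iff_rel, Finpartition.part_eq_of_mem _ hV ha]
  exact hb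

theorem eq_of_rel {n : ℕ} (s : Setoid (Fin n)) [DecidableRel s.r] {V W : Finset (Fin n)}
    (hV : V ∈ (Finpartition.ofSetoid s).parts) (hW : W ∈ (Finpartition.ofSetoid s).parts)
    {a b : Fin n} (ha : a ∈ V) (hb : b ∈ W) (h : s a b) : V = W := by
  refine Finpartition.eq_of_mem_parts _ hV hW (a := b) ?_ hb
  rw [← Finpartition.mem_part_ofSetoid_iff_rel, Finpartition.part_eq_of_mem _ hV ha] at h
  exact h

theorem lt_ff {n : ℕ} (i j : Fin n) (x : Bool) :
    (toLex (i, x) : Fin n ×ₗ Bool) < toLex (j, x) ↔ i < j := by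
  simp [Prod.Lex.toLex_lt_toLex]

theorem lt_ft {n : ℕ} (i j : Fin n) :
    (toLex (i, false) : Fin n ×ₗ Bool) < toLex (j, true) ↔ i ≤ j := by
  simp [Prod.Lex.toLex_lt_toLex, le_iff_lt_or_eq]

theorem lt_tf {n : ℕ} (i j : Fin n) :
    (toLex (i, true) : Fin n ×ₗ Bool) < toLex (j, false) ↔ i < j := by
  simp [Prod.Lex.toLex_lt_toLex]

theorem exists_isGreatest_kreweras {n : ℕ} (π : NC n) :
    ∃ κ : NC n, IsGreatest {κ : NC n | IsNonCrossing (interleave π.1 κ.1)} κ := by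
  classical
  have hnc : IsNonCrossing (Finpartition.ofSetoid (complSetoid π.1)).parts := by
    intro V hV W hW a ha b hb c hc d hd hab hbc hcd
    have h1 := rel_of_mem_parts _ hV ha hc
    have h2 := rel_of_mem_parts _ hW hb hd
    refine eq_of_rel _ hV hW ha hb fun U hU x hx y hy => ?_
    have h3 := h1 U hU x hx y hy
    have h4 := h2 U hU x hx y hy
    grind
  refine ⟨⟨_, hnc⟩, ?_, ?_⟩
  · intro V hV W hW a ha b hb c hc d hd hab hbc hcd
    simp only [interleave, Finset.mem_union, Finset.mem_image] at hV hW
    rcases hV with ⟨V, hV, rfl⟩ | ⟨V, hV, rfl⟩ <;> rcases hW with ⟨W, hW, rfl⟩ | ⟨W, hW, rfl⟩ <;>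
      (obtain ⟨a, ha', rfl⟩ := Finset.mem_image.1 ha
       obtain ⟨b, hb', rfl⟩ := Finset.mem_image.1 hb
       obtain ⟨c, hc', rfl⟩ := Finset.mem_image.1 hc
       obtain ⟨d, hd', rfl⟩ := Finset.mem_image.1 hd
       simp only [lt_ff, lt_ft, lt_tf] at hab hbc hcd)
    · rw [π.2 V hV W hW a ha' b hb' c hc' d hd' hab hbc hcd]
    · have := rel_of_mem_parts _ hW hb' hd' V hV a ha' c hc'
      grind
    · have := rel_of_mem_parts _ hV ha' hc' W hW b hb' d hd'
      grind
    · rw [hnc V hV W hW a ha' b hb' c hc' d hd' hab hbc hcd]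
  · intro κ hκ W hW
    obtain ⟨w, hw⟩ := κ.1.nonempty_of_mem_parts hW
    refine ⟨(Finpartition.ofSetoid (complSetoid π.1)).part w,
      Finpartition.part_mem _ |>.2 (Finset.mem_univ _), fun v hv => ?_⟩
    rw [Finpartition.mem_part_ofSetoid_iff_rel]
    -- If a block of `π` were separated by two points of a block of `κ`, the two would cross.
    have hcross : ∀ i ∈ W, ∀ j ∈ W, ∀ V ∈ π.1.parts, ∀ a ∈ V, ∀ b ∈ V,
        i < a → a ≤ j → (b ≤ i ∨ j < b) → False := by
      intro i hi j hj V hV a ha b hb hia haj hbij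
      have hVm : V.image (fun i => (toLex (i, false) : Fin n ×ₗ Bool)) ∈ interleave π.1 κ.1 :=
        Finset.mem_union_left _ (Finset.mem_image_of_mem _ hV)
      have hWm : W.image (fun i => (toLex (i, true) : Fin n ×ₗ Bool)) ∈ interleave π.1 κ.1 :=
        Finset.mem_union_right _ (Finset.mem_image_of_mem _ hW)
      have hne : V.image (fun i => (toLex (i, false) : Fin n ×ₗ Bool)) ≠
          W.image (fun i => (toLex (i, true) : Fin n ×ₗ Bool)) := by
        intro he
        have := Finset.mem_image_of_mem (fun i => (toLex (i, false) : Fin n ×ₗ Bool)) ha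
        rw [he] at this
        simp at this
      rcases hbij with hb' | hb'
      · exact hne (hκ _ hVm _ hWm _ (Finset.mem_image_of_mem _ hb) _
          (Finset.mem_image_of_mem _ hi) _ (Finset.mem_image_of_mem _ ha) _
          (Finset.mem_image_of_mem _ hj) ((lt_ft _ _).2 hb') ((lt_tf _ _).2 hia)
          ((lt_ft _ _).2 haj))
      · exact hne.symm (hκ _ hWm _ hVm _ (Finset.mem_image_of_mem _ hi) _
          (Finset.mem_image_of_mem _ ha) _ (Finset.mem_image_of_mem _ hj) _
          (Finset.mem_image_of_mem _ hb) ((lt_tf _ _).2 hia) ((lt_ft _ _).2 haj)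
          ((lt_tf _ _).2 hb'))
    intro V hV a ha b hb
    have h1 := hcross w hw v hv V hV a ha b hb
    have h2 := hcross w hw v hv V hV b hb a ha
    have h3 := hcross v hv w hw V hV a ha b hb
    have h4 := hcross v hv w hw V hV b hb a ha
    grind

/-- The Kreweras complement: the largest `K(π) ∈ NC(1̄, …, n̄) ≅ NC(n)` such that
`π ∪ K(π)` is non-crossing. -/
noncomputable def kreweras {n : ℕ} (π : NC n) : NC n :=
  (exists_isGreatest_kreweras π).choose

theorem kreweras_isGreatest {n : ℕ} (π : NC n) :
    IsGreatest {κ : NC n | IsNonCrossing (interleave π.1 κ.1)} (kreweras π) :=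
  (exists_isGreatest_kreweras π).choose_spec

/-- The partition `π` viewed as the permutation whose cycles are the blocks of `π`, ordered
increasingly: `i` is sent to the next larger element of its block, the largest element of a block
to the smallest one. -/
def blockPerm {n : ℕ} (π : NC n) (i : Fin n) : Fin n :=
  if h : {j ∈ π.1.part i | i < j}.Nonempty then {j ∈ π.1.part i | i < j}.min' h
  else (π.1.part i).min' ⟨i, π.1.mem_part (Finset.mem_univ i)⟩

open Classical in
/-- The set `NC(n)_{r,r'}` of pairs `σ ≤ π` with `r'(i) = r(σ(i))` and `r(i) = r'(K(π)(i - 1))`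
for all `i`, with arithmetic modulo `n`. -/
noncomputable def compatiblePairs {n k : ℕ} [NeZero n] (r r' : Fin n → Fin k) :
    Finset (NC n × NC n) :=
  {x | x.1 ≤ x.2 ∧ ∀ i, r' i = r (blockPerm x.1 i) ∧ r i = r' (blockPerm (kreweras x.2) (i - 1))}

end NonCrossing

namespace RectangularSpace

variable {A : Type*} [CStarAlgebra A] [PartialOrder A] [StarOrderedRing A] [WStarAlgebra A]
  {k n : ℕ}

/-- `τ_π[a₁, …, a_n]`, the product over the blocks `{i₁ < ⋯ < i_l}` of `π` of
`τ(a_{i₁} ⋯ a_{i_l})`. -/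
noncomputable def blockTrace (X : RectangularSpace A k) (π : NC n) (a : Fin n → A) : ℂ :=
  ∏ V ∈ π.1.parts, X.τ ((V.sort (· ≤ ·)).map a).prod

/-- The weight `ω(σ, π)_{r,r'}`: the product of `τ(p_{r'(i)})⁻¹` over all `i` with `σ(i) ≤ i` and of
`τ(p_{r(j+1)})⁻¹` over all `j` different from the last index (`j + 1 ≠ 0` modulo `n`) with
`K(π)(j) ≤ j`. -/
noncomputable def weight [NeZero n] (X : RectangularSpace A k) (r r' : Fin n → Fin k)
    (σ π : NC n) : ℂ :=
  (∏ i with blockPerm σ i ≤ i, (X.τ (X.p (r' i)))⁻¹) *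
    ∏ j with j + 1 ≠ 0 ∧ blockPerm (kreweras π) j ≤ j, (X.τ (X.p (r (j + 1))))⁻¹

end RectangularSpace

end RectangularProbability

open RectangularProbability

/-! Let φ be the functional `cornerTrace`: on a diagonal corner it is the normalised trace
τ(p_x)⁻¹τ, it kills off-diagonal corners, φ(p_x) = 1, and F(a) = φ(a) p_x for a in A^{(x,y)}. With
φ_π the product of φ over the block products of π (`moment`), the claim becomes φ(D₁C₁⋯DₙCₙ) = ∑
φ_σ[D] φ_{K(π)}[C] μ(σ,π), whose right side is `mixedSum`. Labels and weights return only at the end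
(`mixedSum_eq`): a term with mismatched labels vanishes, and the normalising factors, one per block,
sit at the block maxima and form ω.

No theory of cumulants is needed. The difference of the two sides (`defect`) is multilinear and
vanishes by induction on n (`defect_eq_zero`). Every D except the first and every C except the last
is split into a centred part and a multiple of a projection. If all these letters are centred, the
left side is zero by freeness (`expect_alternating_eq_zero`) and the right side is zero term by term
(`mixedSum_eq_zero`): either σ has a singleton away from the first point, or σ, hence π, joins two
neighbours and K(π) isolates the barred point between them.

If a letter is a projection, its neighbour absorbs it and the word gets shorter; the mixed sum must
shorten alike (`mixedSum_erase_right`, `mixedSum_erase_left`). Merging two letters of one family and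
deleting a letter of the other correspond to the two halves of a Galois connection between lattices
of non-crossing partitions, because K(π) joins i and j iff π ≤ `sep i j`; Rota's theorem
(`sum_ncMu_galois`) then compares the sums. Deleting the projection preserves its moment
(`moment_erase`) because the other moment, if nonzero, balances the labels over a suitable set and
so excludes a single mismatch. -/

namespace RectangularProbability

/-! ### Non-crossing partitions as equivalence relations -/

namespace NC

variable {n m : ℕ}

/-- `a` and `b` lie in the same block of `π`. -/
def Rel (π : NC n) (a b : Fin n) : Prop := b ∈ π.1.part a

theorem rel_iff_part_eq {π : NC n} {a b : Fin n} : π.Rel a b ↔ π.1.part a = π.1.part b := by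
  rw [Rel, Finpartition.mem_part_iff_part_eq_part _ (Finset.mem_univ _) (Finset.mem_univ _)]
  exact eq_comm

theorem Rel.refl (π : NC n) (a : Fin n) : π.Rel a a := rel_iff_part_eq.2 rfl

theorem Rel.symm {π : NC n} {a b : Fin n} (h : π.Rel a b) : π.Rel b a :=
  rel_iff_part_eq.2 (rel_iff_part_eq.1 h).symm

theorem Rel.trans {π : NC n} {a b c : Fin n} (h : π.Rel a b) (h' : π.Rel b c) : π.Rel a c :=
  rel_iff_part_eq.2 ((rel_iff_part_eq.1 h).trans (rel_iff_part_eq.1 h'))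

theorem part_mem_parts (π : NC n) (a : Fin n) : π.1.part a ∈ π.1.parts :=
  π.1.part_mem.2 (Finset.mem_univ a)

theorem mem_parts_iff {π : NC n} {V : Finset (Fin n)} :
    V ∈ π.1.parts ↔ ∃ a, V = π.1.part a := by
  constructor
  · intro hV
    obtain ⟨a, ha⟩ := π.1.nonempty_of_mem_parts hV
    exact ⟨a, (π.1.part_eq_of_mem hV ha).symm⟩
  · rintro ⟨a, rfl⟩
    exact π.part_mem_parts a

theorem Rel.of_lt (π : NC n) {a b c d : Fin n} (hab : a < b) (hbc : b < c) (hcd : c < d)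
    (hac : π.Rel a c) (hbd : π.Rel b d) : π.Rel a b :=
  rel_iff_part_eq.2 <| π.2 _ (π.part_mem_parts a) _ (π.part_mem_parts b) a (Rel.refl π a) b
    (Rel.refl π b) c hac d hbd hab hbc hcd

theorem le_iff {σ π : NC n} : σ ≤ π ↔ ∀ a b, σ.Rel a b → π.Rel a b := by
  constructor
  · intro h a b hab
    obtain ⟨W, hW, hVW⟩ := h (σ.part_mem_parts a)
    rw [Rel, π.1.part_eq_of_mem hW (hVW (Rel.refl σ a))]
    exact hVW hab
  · intro h V hV
    obtain ⟨a, rfl⟩ := mem_parts_iff.1 hV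
    exact ⟨π.1.part a, π.part_mem_parts a, fun b hb => h a b hb⟩

theorem ext_rel {σ π : NC n} (h : ∀ a b, σ.Rel a b ↔ π.Rel a b) : σ = π :=
  le_antisymm (le_iff.2 fun a b => (h a b).1) (le_iff.2 fun a b => (h a b).2)

open Classical in
/-- The non-crossing partition given by an equivalence relation. -/
noncomputable def ofSetoid (s : Setoid (Fin n))
    (hs : ∀ a b c d, a < b → b < c → c < d → s a c → s b d → s a b) : NC n :=
  ⟨Finpartition.ofSetoid s, fun _ hV _ hW a ha b hb c hc d hd hab hbc hcd =>
    eq_of_rel s hV hW ha hb (hs a b c d hab hbc hcd (rel_of_mem_parts s hV ha hc)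
      (rel_of_mem_parts s hW hb hd))⟩

theorem ofSetoid_rel {s : Setoid (Fin n)} {hs} {a b : Fin n} : (ofSetoid s hs).Rel a b ↔ s a b := by
  classical
  exact Finpartition.mem_part_ofSetoid_iff_rel

/-- The pullback of a non-crossing partition along a monotone map. -/
noncomputable def comap (f : Fin m → Fin n) (hf : Monotone f) (π : NC n) : NC m :=
  ofSetoid ⟨fun a b => π.Rel (f a) (f b), fun a => Rel.refl π _, fun h => h.symm,
    fun h h' => h.trans h'⟩ <| by
  intro a b c d hab hbc hcd hac hbd
  change π.Rel (f a) (f c) at hac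
  change π.Rel (f b) (f d) at hbd
  show π.Rel (f a) (f b)
  -- A monotone map may identify points; each coincidence degenerates the crossing and settles the
  -- claim at once.
  rcases (hf hab.le).eq_or_lt with h | h
  · rw [h]; exact Rel.refl π _
  rcases (hf hbc.le).eq_or_lt with h' | h'
  · rw [h']; exact hac
  rcases (hf hcd.le).eq_or_lt with h'' | h''
  · rw [← h''] at hbd; exact hac.trans hbd.symm
  exact Rel.of_lt π h h' h'' hac hbd

theorem comap_rel {f : Fin m → Fin n} {hf : Monotone f} {π : NC n} {a b : Fin m} :
    (comap f hf π).Rel a b ↔ π.Rel (f a) (f b) := ofSetoid_rel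

/-- The largest partition none of whose blocks separates the barred points `i` and `j`. It has at
most two blocks. -/
noncomputable def sep (i j : Fin n) : NC n :=
  ofSetoid ⟨fun a b => (a ≤ i ↔ a ≤ j) ↔ (b ≤ i ↔ b ≤ j), fun _ => Iff.rfl, fun h => h.symm,
    fun h h' => h.trans h'⟩ <| by
  intro a b c d hab hbc hcd (hac : (a ≤ i ↔ a ≤ j) ↔ (c ≤ i ↔ c ≤ j))
    (hbd : (b ≤ i ↔ b ≤ j) ↔ (d ≤ i ↔ d ≤ j))
  show (a ≤ i ↔ a ≤ j) ↔ (b ≤ i ↔ b ≤ j)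
  grind

theorem sep_rel {i j a b : Fin n} :
    (sep i j).Rel a b ↔ ((a ≤ i ↔ a ≤ j) ↔ (b ≤ i ↔ b ≤ j)) := ofSetoid_rel

/-- By the adjunction `f a ≤ i` means `a ≤ g i`, so the cut points move along the right adjoint. -/
theorem comap_sep {f : Fin m → Fin n} {g : Fin n → Fin m} (h : GaloisConnection f g) (i j : Fin n) :
    comap f h.monotone_l (sep i j) = sep (g i) (g j) := by
  refine ext_rel fun a b => ?_
  rw [comap_rel, sep_rel, sep_rel, h a i, h a j, h b i, h b j]

/-- The left adjoint of `comap f`. -/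
noncomputable def map (f : Fin m → Fin n) (hf : Monotone f) (π : NC m) : NC n :=
  ofSetoid ⟨fun a b => ∀ ρ : NC n, π ≤ comap f hf ρ → ρ.Rel a b, fun a ρ _ => Rel.refl ρ a,
    fun h ρ hρ => (h ρ hρ).symm, fun h h' ρ hρ => (h ρ hρ).trans (h' ρ hρ)⟩
  fun _ _ _ _ hab hbc hcd hac hbd ρ hρ => Rel.of_lt ρ hab hbc hcd (hac ρ hρ) (hbd ρ hρ)

theorem map_rel {f : Fin m → Fin n} {hf : Monotone f} {π : NC m} {a b : Fin n} :
    (map f hf π).Rel a b ↔ ∀ ρ : NC n, π ≤ comap f hf ρ → ρ.Rel a b := ofSetoid_rel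

theorem gc_map_comap (f : Fin m → Fin n) (hf : Monotone f) :
    GaloisConnection (map f hf) (comap f hf) := by
  intro π ρ
  constructor
  · intro h
    refine le_iff.2 fun a b hab => comap_rel.2 (le_iff.1 h _ _ (map_rel.2 fun ρ' hρ' => ?_))
    exact comap_rel.1 (le_iff.1 hρ' _ _ hab)
  · intro h
    exact le_iff.2 fun a b hab => map_rel.1 hab ρ h

/-! ### The Kreweras complement -/

/-- A block of π crosses the pair of barred points i, j exactly when it meets both sides of the cut
they make. The complement thus becomes an order relation in `NC n`, to which adjunctions apply. -/
theorem kreweras_rel {π : NC n} {i j : Fin n} : (kreweras π).Rel i j ↔ π ≤ sep i j := by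
  classical
  constructor
  · intro hij
    refine le_iff.2 fun a b hab => sep_rel.2 ?_
    have hcross : ∀ i j a b, (kreweras π).Rel i j → π.Rel a b →
        i < a → a ≤ j → (b ≤ i ∨ j < b) → False := by
      intro i j a b hij hab hia haj hbij
      have hVm : (π.1.part a).image (fun i => (toLex (i, false) : Fin n ×ₗ Bool)) ∈
          interleave π.1 (kreweras π).1 :=
        Finset.mem_union_left _ (Finset.mem_image_of_mem _ (π.part_mem_parts a))
      have hWm : ((kreweras π).1.part i).image (fun i => (toLex (i, true) : Fin n ×ₗ Bool)) ∈
          interleave π.1 (kreweras π).1 :=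
        Finset.mem_union_right _ (Finset.mem_image_of_mem _ ((kreweras π).part_mem_parts i))
      have hav := Finset.mem_image_of_mem (fun i => (toLex (i, false) : Fin n ×ₗ Bool))
        (Rel.refl π a)
      have hbv := Finset.mem_image_of_mem (fun i => (toLex (i, false) : Fin n ×ₗ Bool)) hab
      have hiw := Finset.mem_image_of_mem (fun i => (toLex (i, true) : Fin n ×ₗ Bool))
        (Rel.refl (kreweras π) i)
      have hjw := Finset.mem_image_of_mem (fun i => (toLex (i, true) : Fin n ×ₗ Bool)) hij
      have hne : (π.1.part a).image (fun i => (toLex (i, false) : Fin n ×ₗ Bool)) ≠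
          ((kreweras π).1.part i).image (fun i => (toLex (i, true) : Fin n ×ₗ Bool)) := by
        intro he
        rw [he] at hav
        simp at hav
      have hK := (kreweras_isGreatest π).1
      rcases hbij with hb' | hb'
      · exact hne (hK _ hVm _ hWm _ hbv _ hiw _ hav _ hjw ((lt_ft _ _).2 hb') ((lt_tf _ _).2 hia)
          ((lt_ft _ _).2 haj))
      · exact hne.symm (hK _ hWm _ hVm _ hiw _ hav _ hjw _ hbv
          ((lt_tf _ _).2 hia) ((lt_ft _ _).2 haj) ((lt_tf _ _).2 hb'))
    have h1 := hcross i j a b hij hab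
    have h2 := hcross i j b a hij hab.symm
    have h3 := hcross j i a b hij.symm hab
    have h4 := hcross j i b a hij.symm hab.symm
    grind
  · intro h
    have hs : ∀ i j, complSetoid π.1 i j ↔ π ≤ sep i j := by
      intro i j
      constructor
      · intro h
        exact le_iff.2 fun a b hab => sep_rel.2
          (h _ (π.part_mem_parts a) a (Rel.refl π a) b hab)
      · intro h V hV a ha b hb
        obtain ⟨c, rfl⟩ := mem_parts_iff.1 hV
        exact sep_rel.1 (le_iff.1 h a b (Rel.trans (Rel.symm ha) hb))
    -- The relation `π ≤ sep i j` is itself a non-crossing partition compatible with π, hence lies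
    -- below the largest one.
    let κ : NC n := ofSetoid (complSetoid π.1) <| by
      intro a b c d hab hbc hcd hac hbd V hV x hx y hy
      have h3 := hac V hV x hx y hy
      have h4 := hbd V hV x hx y hy
      grind
    have hκ : κ ≤ kreweras π := by
      refine (kreweras_isGreatest π).2 ?_
      intro V hV W hW a ha b hb c hc d hd hab hbc hcd
      simp only [interleave, Finset.mem_union, Finset.mem_image] at hV hW
      rcases hV with ⟨V, hV, rfl⟩ | ⟨V, hV, rfl⟩ <;>
        rcases hW with ⟨W, hW, rfl⟩ | ⟨W, hW, rfl⟩ <;>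
        (obtain ⟨a, ha', rfl⟩ := Finset.mem_image.1 ha
         obtain ⟨b, hb', rfl⟩ := Finset.mem_image.1 hb
         obtain ⟨c, hc', rfl⟩ := Finset.mem_image.1 hc
         obtain ⟨d, hd', rfl⟩ := Finset.mem_image.1 hd
         simp only [lt_ff, lt_ft, lt_tf] at hab hbc hcd)
      · rw [π.2 V hV W hW a ha' b hb' c hc' d hd' hab hbc hcd]
      · have := rel_of_mem_parts _ hW hb' hd' V hV a ha' c hc'
        grind
      · have := rel_of_mem_parts _ hV ha' hc' W hW b hb' d hd'
        grind
      · rw [κ.2 V hV W hW a ha' b hb' c hc' d hd' hab hbc hcd]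
    exact le_iff.1 hκ _ _ (ofSetoid_rel.2 ((hs i j).2 h))

theorem kreweras_map {f : Fin m → Fin n} {g : Fin n → Fin m} (h : GaloisConnection f g) (π : NC m) :
    kreweras (map f h.monotone_l π) = comap g h.monotone_u (kreweras π) := by
  refine ext_rel fun i j => ?_
  rw [kreweras_rel, gc_map_comap f h.monotone_l π, comap_sep h, comap_rel, kreweras_rel]

theorem kreweras_antitone {σ π : NC n} (h : σ ≤ π) : kreweras π ≤ kreweras σ :=
  le_iff.2 fun _ _ hab => kreweras_rel.2 (h.trans (kreweras_rel.1 hab))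

/-! ### Partitions as permutations -/

/-- Pure order inequalities in place of `min'` and `part`, a form that `grind` and `omega` can use.
-/
theorem blockPerm_eq_iff {π : NC n} {i k : Fin n} :
    blockPerm π i = k ↔ π.Rel i k ∧ ((i < k ∧ ∀ y, π.Rel i y → y ≤ i ∨ k ≤ y) ∨
      (k ≤ i ∧ ∀ y, π.Rel i y → k ≤ y ∧ y ≤ i)) := by
  have hmem : ∀ y, y ∈ ({j ∈ π.1.part i | i < j} : Finset (Fin n)) ↔ π.Rel i y ∧ i < y := by
    intro y; rw [Finset.mem_filter]; rfl
  unfold blockPerm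
  split_ifs with h
  · have h1 := (hmem _).1 (Finset.min'_mem _ h)
    have h2 : ∀ y, π.Rel i y → i < y → Finset.min' _ h ≤ y :=
      fun y hy hiy => Finset.min'_le _ _ ((hmem y).2 ⟨hy, hiy⟩)
    generalize Finset.min' _ h = x at h1 h2
    constructor
    · rintro rfl
      refine ⟨h1.1, Or.inl ⟨h1.2, fun y hy => ?_⟩⟩
      have := h2 y hy
      grind
    · rintro ⟨hik, ⟨hk, hy⟩ | ⟨hk, hy⟩⟩
      · have := hy x h1.1
        have := h2 k hik hk
        grind
      · have := hy x h1.1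
        grind
  · have hne : (π.1.part i).Nonempty := ⟨i, Rel.refl π i⟩
    have h1 : π.Rel i (Finset.min' _ hne) := Finset.min'_mem _ hne
    have h2 : ∀ y, π.Rel i y → Finset.min' _ hne ≤ y := fun y hy => Finset.min'_le _ _ hy
    have h3 : ∀ y, π.Rel i y → y ≤ i := by
      intro y hy
      by_contra! hlt
      exact h ⟨y, (hmem y).2 ⟨hy, hlt⟩⟩
    change Finset.min' _ hne = k ↔ _
    generalize Finset.min' _ hne = x at h1 h2
    constructor
    · rintro rfl
      exact ⟨h1, Or.inr ⟨h2 i (Rel.refl π i), fun y hy => ⟨h2 y hy, h3 y hy⟩⟩⟩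
    · rintro ⟨hik, ⟨hk, hy⟩ | ⟨hk, hy⟩⟩
      · have := h3 k hik
        grind
      · have := hy x h1
        have := h2 k hik
        grind

theorem rel_blockPerm (π : NC n) (i : Fin n) : π.Rel i (blockPerm π i) :=
  (blockPerm_eq_iff.1 rfl).1

theorem blockPerm_injective (π : NC n) : Function.Injective (blockPerm π) := by
  intro i j hij
  have h1 := (blockPerm_eq_iff (π := π) (i := i)).1 rfl
  have h2 := (blockPerm_eq_iff (π := π) (i := j)).1 rfl
  rw [← hij] at h2
  have hr : π.Rel i j := h1.1.trans h2.1.symm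
  have hr' := hr.symm
  grind

theorem blockPerm_bijective (π : NC n) : Function.Bijective (blockPerm π) :=
  Finite.injective_iff_bijective.1 (blockPerm_injective π)

/-- Let x be the predecessor of j + 1 in its π-block. No block crosses the chord from x to j + 1, so
the complement joins j to x; a further partner y of j may not separate x from j + 1, so none comes
cyclically between j and x. -/
theorem blockPerm_kreweras [NeZero n] (π : NC n) (j : Fin n) :
    blockPerm π (blockPerm (kreweras π) j) = j + 1 := by
  obtain ⟨x, hx⟩ := (blockPerm_bijective π).2 (j + 1)
  suffices blockPerm (kreweras π) j = x by rw [this, hx]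
  obtain ⟨hr, hx⟩ := blockPerm_eq_iff.1 hx
  -- Either j is the last index and j + 1 wraps to 0, or there is no wrap; n = 1 belongs to the
  -- first case.
  have hj : (j.1 + 1 = n ∧ (j + 1 : Fin n).1 = 0) ∨ (j.1 + 1 < n ∧ (j + 1 : Fin n).1 = j.1 + 1) := by
    have h1 := Fin.val_add_eq_ite j (1 : Fin n)
    have h2 : (1 : Fin n).1 = 1 % n := rfl
    have h3 := j.2
    rcases Nat.lt_or_ge 1 n with h | h
    · rw [Nat.mod_eq_of_lt h] at h2
      grind
    · have : n = 1 := by omega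
      subst this
      left
      omega
  generalize j + 1 = j' at *
  rw [blockPerm_eq_iff]
  refine ⟨kreweras_rel.2 (le_iff.2 fun a b hab => sep_rel.2 ?_), ?_⟩
  -- If x < j + 1, a block meeting the open gap between them stays in it. Otherwise x is the maximum
  -- and j + 1 the minimum of their block, and a block meeting [j + 1, x] stays in it.
  · rcases hx with ⟨hxj, hc⟩ | ⟨hxj, hc⟩
    · have key : ∀ a b, π.Rel a b → x < a ∧ a < j' → x < b ∧ b < j' := by
        rintro a b hab ⟨hxa, haj⟩
        have hna : ¬ π.Rel x a := fun h => (hc a h).elim (fun h => h.not_gt hxa)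
          (fun h => h.not_gt haj)
        by_contra hb
        rcases lt_trichotomy b x with h | rfl | h
        · exact hna ((Rel.of_lt π h hxa haj hab.symm hr).symm.trans hab.symm)
        · exact hna hab.symm
        · rcases (not_lt.1 fun h' => hb ⟨h, h'⟩).eq_or_lt with rfl | h'
          · exact hna (hr.trans hab.symm)
          · exact hna (Rel.of_lt π hxa haj h' hr hab)
      have k1 := key a b hab
      have k2 := key b a hab.symm
      clear key hc
      simp only [Fin.lt_def, Fin.le_def] at *
      omega
    · have key : ∀ a b, π.Rel a b → j' ≤ a ∧ a ≤ x → j' ≤ b ∧ b ≤ x := by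
        rintro a b hab ⟨hja, hax⟩
        by_cases hxb : π.Rel x b
        · exact hc b hxb
        rcases hax.eq_or_lt with rfl | hax
        · exact absurd hab hxb
        rcases hja.eq_or_lt with rfl | hja
        · exact absurd (hr.trans hab) hxb
        by_contra hb
        rcases lt_or_ge b j' with h | h
        · exact hxb (hr.trans (Rel.of_lt π h hja hax hab.symm hr.symm).symm)
        · exact hxb (hr.trans ((Rel.of_lt π hja hax (not_le.1 fun h' => hb ⟨h, h'⟩)
            hr.symm hab).trans hab))
      have k1 := key a b hab
      have k2 := key b a hab.symm
      have ha := a.2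
      have hb := b.2
      clear key hc
      simp only [Fin.le_def] at *
      omega
  · have hK : ∀ y, (kreweras π).Rel j y →
        ((x ≤ j ↔ x ≤ y) ↔ (j' ≤ j ↔ j' ≤ y)) :=
      fun y hy => sep_rel.1 (le_iff.1 (kreweras_rel.1 hy) _ _ hr)
    have hx' : x < j' ∨ j' ≤ x := lt_or_ge _ _
    by_cases hxj : j < x
    · refine Or.inl ⟨hxj, fun y hy => ?_⟩
      have := hK y hy
      simp only [Fin.lt_def, Fin.le_def] at *
      omega
    · refine Or.inr ⟨not_lt.1 hxj, fun y hy => ?_⟩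
      have := hK y hy
      have := y.2
      simp only [Fin.lt_def, Fin.le_def] at *
      omega

end NC
end RectangularProbability

namespace RectangularProbability

/-! ### The Möbius function -/

section Mobius

open Classical

variable {n m : ℕ}

/-- No lower bound on the summation index is needed, as μ vanishes off the order relation; this
eases exchanging sums. -/
theorem sum_ncMu_le (σ π : NC n) :
    ∑ x, (if x ≤ π then ncMu σ x else 0) = if σ = π then 1 else 0 := by
  let _ : LocallyFiniteOrder (NC n) := Fintype.toLocallyFiniteOrder
  rw [← IncidenceAlgebra.sum_Icc_mu_right (𝕜 := ℂ) σ π, ← Finset.sum_filter]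
  symm
  refine Finset.sum_subset (fun x hx => ?_) (fun x hx hx' => ?_)
  · simp [(Finset.mem_Icc.1 hx).2]
  · refine IncidenceAlgebra.apply_eq_zero_of_not_le (fun h => hx' ?_) _
    exact Finset.mem_Icc.2 ⟨h, (Finset.mem_filter.1 hx).2⟩

theorem ncMu_self (σ : NC n) : ncMu σ σ = 1 := by
  let _ : LocallyFiniteOrder (NC n) := Fintype.toLocallyFiniteOrder
  exact IncidenceAlgebra.mu_self (𝕜 := ℂ) σ

theorem ncMu_eq_zero {σ π : NC n} (h : ¬ σ ≤ π) : ncMu σ π = 0 := by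
  let _ : LocallyFiniteOrder (NC n) := Fintype.toLocallyFiniteOrder
  exact IncidenceAlgebra.apply_eq_zero_of_not_le h _

theorem eq_of_sum_le_eq {Q : Type*} [PartialOrder Q] [Fintype Q] {f g : Q → ℂ}
    (h : ∀ x, ∑ q, (if q ≤ x then f q else 0) = ∑ q, (if q ≤ x then g q else 0)) : f = g := by
  funext x
  induction x using WellFoundedLT.induction with
  | ind x ih =>
    have key : ∀ f : Q → ℂ, ∑ q, (if q ≤ x then f q else 0)
        = f x + ∑ q, (if q < x then f q else 0) := by
      intro f
      have hx : f x = ∑ q, if q = x then f q else 0 := by simp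
      rw [hx, ← Finset.sum_add_distrib]
      refine Finset.sum_congr rfl fun q _ => ?_
      rcases eq_or_ne q x with rfl | hq
      · simp
      · simp [hq, lt_iff_le_and_ne]
    have h2 := h x
    rw [key, key] at h2
    have h3 : ∑ q, (if q < x then f q else 0) = ∑ q, (if q < x then g q else 0) := by
      refine Finset.sum_congr rfl fun q _ => ?_
      split_ifs with hq
      · exact ih q hq
      · rfl
    rw [h3] at h2
    exact add_right_cancel h2

/-- Rota's Galois connection theorem for the lattices of non-crossing partitions. -/
theorem sum_ncMu_galois {l : NC m → NC n} {u : NC n → NC m} (h : GaloisConnection l u)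
    (p : NC m) (q : NC n) :
    ∑ p', (if l p' = q then ncMu p p' else 0) = ∑ q', (if u q' = p then ncMu q' q else 0) := by
  refine congrFun (eq_of_sum_le_eq (f := fun q => ∑ p', (if l p' = q then ncMu p p' else 0))
    (g := fun q => ∑ q', (if u q' = p then ncMu q' q else 0)) fun x => ?_) q
  -- Summed over q ≤ x, both sides are the indicator of u x = p: on the left, l p' ≤ x means p' ≤ u
  -- x.
  trans (if u x = p then (1 : ℂ) else 0)
  · rw [← if_congr (eq_comm (a := p)) rfl rfl, ← sum_ncMu_le p (u x)]
    simp_rw [← h _ _]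
    have : ∀ q : NC n, (if q ≤ x then ∑ p', (if l p' = q then ncMu p p' else 0) else 0)
        = ∑ p', (if l p' = q then (if l p' ≤ x then ncMu p p' else 0) else 0) := by
      intro q
      split_ifs with hq
      · refine Finset.sum_congr rfl fun p' _ => ?_
        split_ifs with h1 h2
        · rfl
        · exact absurd (h1 ▸ hq) h2
        · rfl
      · refine (Finset.sum_eq_zero fun p' _ => ?_).symm
        split_ifs with h1 h2
        · exact absurd (h1 ▸ h2) hq
        · rfl
        · rfl
    simp_rw [this]
    rw [Finset.sum_comm]
    simp
  · have : ∀ q : NC n, (if q ≤ x then ∑ q', (if u q' = p then ncMu q' q else 0) else 0)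
        = ∑ q', (if u q' = p then (if q ≤ x then ncMu q' q else 0) else 0) := by
      intro q
      split_ifs with hq
      · rfl
      · simp
    simp_rw [this]
    rw [Finset.sum_comm]
    have : ∀ q' : NC n, ∑ q, (if u q' = p then (if q ≤ x then ncMu q' q else 0) else 0)
        = if q' = x then (if u q' = p then 1 else 0) else 0 := by
      intro q'
      by_cases h1 : u q' = p
      · simp only [h1, if_true, sum_ncMu_le]
      · simp [h1]
    simp_rw [this]
    simp

/-- Group σ by the value of u and p' by the value of l; the inner sums are the two sides of Rota's
theorem. -/
theorem sum_mul_ncMu_galois {l : NC m → NC n} {u : NC n → NC m} (h : GaloisConnection l u)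
    (f : NC m → ℂ) (g : NC n → ℂ) :
    ∑ σ, ∑ π, f (u σ) * g π * ncMu σ π = ∑ p, ∑ p', f p * g (l p') * ncMu p p' := by
  have h1 : ∀ σ π : NC n, f (u σ) * g π * ncMu σ π =
      ∑ p, f p * g π * (if u σ = p then ncMu σ π else 0) := by
    intro σ π
    simp
  have h2 : ∀ p p' : NC m, f p * g (l p') * ncMu p p' =
      ∑ π, f p * g π * (if l p' = π then ncMu p p' else 0) := by
    intro σ π
    simp
  have h3 : ∑ σ, ∑ π, f (u σ) * g π * ncMu σ π =
      ∑ p, ∑ π, f p * g π * ∑ σ, (if u σ = p then ncMu σ π else 0) := by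
    simp_rw [h1, Finset.mul_sum]
    rw [Finset.sum_comm, Finset.sum_comm (s := (Finset.univ : Finset (NC m)))]
    exact Finset.sum_congr rfl fun π _ => Finset.sum_comm
  have h4 : ∑ p, ∑ p', f p * g (l p') * ncMu p p' =
      ∑ p, ∑ π, f p * g π * ∑ p', (if l p' = π then ncMu p p' else 0) := by
    simp_rw [h2, Finset.mul_sum]
    exact Finset.sum_congr rfl fun p _ => Finset.sum_comm
  rw [h3, h4]
  simp_rw [sum_ncMu_galois h]

end Mobius
end RectangularProbability

namespace RectangularProbability

/-! ### Ordered products -/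

section OrderedProducts

variable {M : Type*} [Monoid M] {n : ℕ}

/-- Block products are treated as ordered products over all of `Fin n` padded with 1, so cutting one
at i means padding the two halves. -/
theorem prod_ofFn_split (f g h : Fin n → M) (i : Fin n) (hf : ∀ j, i < j → f j = 1)
    (hg : ∀ j, j ≤ i → g j = 1) (hfh : ∀ j, j ≤ i → h j = f j) (hgh : ∀ j, i < j → h j = g j) :
    (List.ofFn h).prod = (List.ofFn f).prod * (List.ofFn g).prod := by
  induction n with
  | zero => exact i.elim0
  | succ n ih =>
    rw [List.ofFn_succ, List.ofFn_succ, List.ofFn_succ, List.prod_cons, List.prod_cons,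
      List.prod_cons, hg 0 (Fin.zero_le _), hfh 0 (Fin.zero_le _), one_mul, mul_assoc]
    congr 1
    cases i using Fin.cases with
    | zero =>
      have h1 : (List.ofFn fun j : Fin n => f j.succ).prod = 1 := by
        refine List.prod_eq_one fun x hx => ?_
        obtain ⟨j, rfl⟩ := List.mem_ofFn.1 hx
        exact hf _ (Fin.succ_pos j)
      rw [h1, one_mul]
      congr 2
      funext j
      exact hgh _ (Fin.succ_pos j)
    | succ i =>
      exact ih _ _ _ i (fun j hj => hf _ (Fin.succ_lt_succ_iff.2 hj))
        (fun j hj => hg _ (Fin.succ_le_succ_iff.2 hj))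
        (fun j hj => hfh _ (Fin.succ_le_succ_iff.2 hj))
        (fun j hj => hgh _ (Fin.succ_lt_succ_iff.2 hj))

theorem prod_ofFn_pull_left (f g : Fin n → M) (i : Fin n) (hf : ∀ j, j < i → f j = 1)
    (hg : g i = 1) (hfg : ∀ j, j ≠ i → g j = f j) :
    (List.ofFn f).prod = f i * (List.ofFn g).prod := by
  induction n with
  | zero => exact i.elim0
  | succ n ih =>
    rw [List.ofFn_succ, List.ofFn_succ, List.prod_cons, List.prod_cons]
    cases i using Fin.cases with
    | zero =>
      rw [hg, one_mul]
      congr 3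
      funext j
      exact (hfg _ (Fin.succ_ne_zero j)).symm
    | succ i =>
      rw [hf 0 (Fin.succ_pos i), hfg 0 (Fin.succ_ne_zero i).symm, hf 0 (Fin.succ_pos i), one_mul,
        one_mul]
      exact ih _ _ i (fun j hj => hf _ (Fin.succ_lt_succ_iff.2 hj)) hg
        (fun j hj => hfg _ (fun h => hj (Fin.succ_injective _ h)))

theorem prod_ofFn_pull_right (f g : Fin n → M) (i : Fin n) (hf : ∀ j, i < j → f j = 1)
    (hg : g i = 1) (hfg : ∀ j, j ≠ i → g j = f j) :
    (List.ofFn f).prod = (List.ofFn g).prod * f i := by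
  induction n with
  | zero => exact i.elim0
  | succ n ih =>
    rw [List.ofFn_succ, List.ofFn_succ, List.prod_cons, List.prod_cons]
    cases i using Fin.cases with
    | zero =>
      have h1 : (List.ofFn fun j : Fin n => f j.succ).prod = 1 := by
        refine List.prod_eq_one fun x hx => ?_
        obtain ⟨j, rfl⟩ := List.mem_ofFn.1 hx
        exact hf _ (Fin.succ_pos j)
      have h2 : (List.ofFn fun j : Fin n => g j.succ).prod = 1 := by
        refine List.prod_eq_one fun x hx => ?_
        obtain ⟨j, rfl⟩ := List.mem_ofFn.1 hx
        rw [hfg _ (Fin.succ_ne_zero j)]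
        exact hf _ (Fin.succ_pos j)
      rw [h1, h2, hg, one_mul, one_mul, mul_one]
    | succ i =>
      rw [hfg 0 (Fin.succ_ne_zero i).symm, mul_assoc]
      congr 1
      exact ih _ _ i (fun j hj => hf _ (Fin.succ_lt_succ_iff.2 hj)) hg
        (fun j hj => hfg _ (fun h => hj (Fin.succ_injective _ h)))

theorem prod_ofFn_succAbove (f : Fin (n + 1) → M) (j : Fin (n + 1)) (hf : f j = 1) :
    (List.ofFn f).prod = (List.ofFn fun i => f (j.succAbove i)).prod := by
  induction n with
  | zero =>
    obtain rfl : j = 0 := by omega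
    simpa using hf
  | succ n ih =>
    cases j using Fin.cases with
    | zero =>
      rw [List.ofFn_succ, List.prod_cons, hf, one_mul]
      simp
    | succ j =>
      rw [List.ofFn_succ, List.ofFn_succ (f := fun i => f (j.succ.succAbove i)), List.prod_cons,
        List.prod_cons, ih _ j hf]
      simp

/-- The family in which the entries at `i` and `i + 1` have been multiplied. -/
def contract (m : Fin n) (f : Fin (n + 1) → M) (i : Fin n) : M :=
  if i < m then f i.castSucc else if i = m then f i.castSucc * f i.succ else f i.succ

theorem prod_ofFn_contract (m : Fin n) (f : Fin (n + 1) → M) :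
    (List.ofFn (contract m f)).prod = (List.ofFn f).prod := by
  induction n with
  | zero => exact m.elim0
  | succ n ih =>
    rw [List.ofFn_succ, List.ofFn_succ (f := f), List.prod_cons, List.prod_cons]
    cases m using Fin.cases with
    | zero =>
      rw [List.ofFn_succ (f := fun i => f i.succ), List.prod_cons, ← mul_assoc]
      congr 1
    | succ m =>
      rw [← ih m fun i => f i.succ]
      congr 1
      simp only [contract, Fin.succ_inj, Fin.succ_lt_succ_iff]
      rfl

/-- The product in increasing order of the entries with index in `V`. -/
def blockProd (V : Finset (Fin n)) (a : Fin n → M) : M :=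
  (List.ofFn fun i => if i ∈ V then a i else 1).prod

theorem sort_map_prod (V : Finset (Fin n)) (a : Fin n → M) :
    ((V.sort (· ≤ ·)).map a).prod = blockProd V a := by
  have h1 : V.sort (· ≤ ·) = (List.finRange n).filter (· ∈ V) := by
    refine List.Perm.eq_of_pairwise (le := (· ≤ ·)) (fun a b _ _ h h' => le_antisymm h h')
      (Finset.pairwise_sort _ _) ?_ ?_
    · exact ((List.pairwise_lt_finRange n).imp le_of_lt).filter _
    · refine (List.perm_ext_iff_of_nodup (Finset.sort_nodup _ _)
        ((List.nodup_finRange n).filter _)).2 fun x => ?_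
      simp
  have h2 : ∀ l : List (Fin n), ((l.filter (· ∈ V)).map a).prod
      = (l.map fun i => if i ∈ V then a i else 1).prod := by
    intro l
    induction l with
    | nil => rfl
    | cons x l ih =>
      by_cases hx : x ∈ V <;> simp [hx, ih]
  rw [h1, h2, blockProd, List.ofFn_eq_map]

theorem blockProd_succAbove (V : Finset (Fin (n + 1))) (a : Fin (n + 1) → M) (j : Fin (n + 1))
    (h : j ∈ V → a j = 1) :
    blockProd V a = blockProd {i | j.succAbove i ∈ V} fun i => a (j.succAbove i) := by
  rw [blockProd, prod_ofFn_succAbove _ j (by grind)]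
  simp [blockProd]

/-- The preimage under `predAbove` contains both merged positions or neither, so the product over it
may be contracted at m. -/
theorem blockProd_contract (V : Finset (Fin n)) (a : Fin (n + 1) → M) (m : Fin n) :
    blockProd V (contract m a) = blockProd {i | m.predAbove i ∈ V} a := by
  rw [blockProd, blockProd, ← prod_ofFn_contract m]
  congr 2
  funext i
  simp only [contract, Finset.mem_filter, Finset.mem_univ, true_and]
  rcases lt_trichotomy i m with h | rfl | h
  · simp [h, Fin.predAbove_of_le_castSucc, Fin.castSucc_le_castSucc_iff.2 h.le]
  · simp only [lt_irrefl, if_false, if_true, Fin.predAbove_castSucc_self, Fin.predAbove_succ_self]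
    split_ifs <;> simp
  · have h' : m.castSucc < i.succ := by
      simp only [Fin.lt_def, Fin.val_castSucc, Fin.val_succ] at *; omega
    simp [h.not_gt, h.ne', Fin.predAbove_of_castSucc_lt, h']

theorem blockProd_split (V : Finset (Fin n)) (a : Fin n → M) (i : Fin n) :
    blockProd V a = blockProd {j ∈ V | j ≤ i} a * blockProd {j ∈ V | i < j} a := by
  refine prod_ofFn_split _ _ _ i ?_ ?_ ?_ ?_ <;> intro j hj
  · simp [hj]
  · simp [hj]
  · simp [hj]
  · simp [hj]

theorem blockProd_congr {V : Finset (Fin n)} {a b : Fin n → M} (h : ∀ i ∈ V, a i = b i) :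
    blockProd V a = blockProd V b := by
  unfold blockProd
  congr 2
  funext i
  grind

theorem blockProd_pull_left {V : Finset (Fin n)} (a : Fin n → M) {i : Fin n} (hi : i ∈ V)
    (h : ∀ j ∈ V, i ≤ j) : blockProd V a = a i * blockProd V (Function.update a i 1) := by
  unfold blockProd
  rw [prod_ofFn_pull_left (fun j => if j ∈ V then a j else 1)
    (fun j => if j ∈ V then Function.update a i 1 j else 1) i]
  · rw [if_pos hi]
  · intro j hj
    exact if_neg fun h' => (h j h').not_gt hj
  · simp
  · intro j hj
    simp [hj]

theorem blockProd_pull_right {V : Finset (Fin n)} (a : Fin n → M) {i : Fin n} (hi : i ∈ V)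
    (h : ∀ j ∈ V, j ≤ i) : blockProd V a = blockProd V (Function.update a i 1) * a i := by
  unfold blockProd
  rw [prod_ofFn_pull_right (fun j => if j ∈ V then a j else 1)
    (fun j => if j ∈ V then Function.update a i 1 j else 1) i]
  · rw [if_pos hi]
  · intro j hj
    exact if_neg fun h' => (h j h').not_gt hj
  · simp
  · intro j hj
    simp [hj]

theorem mul_blockProd {V : Finset (Fin n)} {a : Fin n → M} {i : Fin n} (hi : i ∈ V)
    (h : ∀ j ∈ V, i ≤ j) {p : M} (hp : p * a i = a i) : p * blockProd V a = blockProd V a := by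
  rw [blockProd_pull_left a hi h, ← mul_assoc, hp]

theorem blockProd_mul {V : Finset (Fin n)} {a : Fin n → M} {i : Fin n} (hi : i ∈ V)
    (h : ∀ j ∈ V, j ≤ i) {p : M} (hp : a i * p = a i) : blockProd V a * p = blockProd V a := by
  rw [blockProd_pull_right a hi h, mul_assoc, hp]

theorem blockProd_singleton (a : Fin n → M) (i : Fin n) : blockProd {i} a = a i := by
  rw [← sort_map_prod]
  simp

theorem blockProd_univ (a : Fin n → M) : blockProd Finset.univ a = (List.ofFn a).prod := by
  simp [blockProd]

end OrderedProducts

/-! ### Blocks of a pulled-back partition -/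

namespace NC

variable {n m : ℕ}

theorem part_comap {f : Fin m → Fin n} {hf : Monotone f} {π : NC n} {a : Fin m} :
    (comap f hf π).1.part a = ({i | f i ∈ π.1.part (f a)} : Finset (Fin m)) := by
  ext i
  rw [Finset.mem_filter]
  exact comap_rel.trans (by simp [Rel])

/-- Blocks of the pullback are the nonempty preimages of blocks, and distinct blocks have disjoint
preimages. -/
theorem prod_parts_comap {f : Fin m → Fin n} {hf : Monotone f} {π : NC n} (g : Finset (Fin m) → ℂ) :
    ∏ V ∈ (comap f hf π).1.parts, g V =
      ∏ V ∈ π.1.parts with ∃ a, f a ∈ V, g {i | f i ∈ V} := by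
  symm
  refine Finset.prod_bij (fun V _ => ({i | f i ∈ V} : Finset (Fin m))) ?_ ?_ ?_ ?_
  · intro V hV
    obtain ⟨hV, a, ha⟩ := Finset.mem_filter.1 hV
    rw [mem_parts_iff]
    exact ⟨a, by rw [part_comap, π.1.part_eq_of_mem hV ha]⟩
  · intro V hV W hW h
    obtain ⟨hV, a, ha⟩ := Finset.mem_filter.1 hV
    obtain ⟨hW, _⟩ := Finset.mem_filter.1 hW
    have : a ∈ ({i | f i ∈ W} : Finset (Fin m)) := h ▸ (by simpa using ha)
    exact π.1.eq_of_mem_parts hV hW ha (by simpa using this)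
  · intro V hV
    obtain ⟨a, rfl⟩ := mem_parts_iff.1 hV
    exact ⟨π.1.part (f a), Finset.mem_filter.2 ⟨π.part_mem_parts _, a, Rel.refl π _⟩,
      part_comap.symm⟩
  · intro V _
    rfl

end NC
end RectangularProbability

namespace RectangularProbability
namespace RectangularSpace

variable {A : Type*} [CStarAlgebra A] [PartialOrder A] [StarOrderedRing A] [WStarAlgebra A]
  {k n : ℕ}

/-! ### The normalised trace -/

/-- The sum of the normalised traces of the diagonal corners. -/
noncomputable def cornerTrace (X : RectangularSpace A k) : A →ₗ[ℂ] ℂ where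
  toFun a := ∑ i, (X.τ (X.p i))⁻¹ * X.τ (X.p i * a)
  map_add' a b := by simp only [mul_add, map_add, Finset.sum_add_distrib]
  map_smul' z a := by
    simp only [mul_smul_comm, map_smul, smul_eq_mul, RingHom.id_apply, Finset.mul_sum,
      mul_left_comm]

theorem cornerTrace_apply (X : RectangularSpace A k) (a : A) :
    X.cornerTrace a = ∑ i, (X.τ (X.p i))⁻¹ * X.τ (X.p i * a) := rfl

theorem expect_apply (X : RectangularSpace A k) (a : A) :
    X.expect a = ∑ i, ((X.τ (X.p i))⁻¹ * X.τ (X.p i * a)) • X.p i := rfl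

theorem cornerTrace_p (X : RectangularSpace A k) (i : Fin k) : X.cornerTrace (X.p i) = 1 := by
  rw [cornerTrace_apply, Finset.sum_eq_single i]
  · rw [(X.p_proj i).isIdempotentElem, inv_mul_cancel₀ (X.τ_p_ne_zero i)]
  · intro j _ hj
    rw [X.p_orthogonal j i hj, map_zero, mul_zero]
  · simp

theorem cornerTrace_expect (X : RectangularSpace A k) (a : A) :
    X.cornerTrace (X.expect a) = X.cornerTrace a := by
  rw [expect_apply, map_sum, cornerTrace_apply]
  simp [cornerTrace_p]

variable {X : RectangularSpace A k} {a b : A} {x y z : Fin k}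

theorem isCorner_iff : X.IsCorner x y a ↔ X.p x * a = a ∧ a * X.p y = a := by
  have hx := (X.p_proj x).isIdempotentElem
  have hy := (X.p_proj y).isIdempotentElem
  constructor
  · intro h
    unfold IsCorner at h
    constructor
    · rw [h, ← mul_assoc, ← mul_assoc, hx.eq]
    · rw [h, mul_assoc, hy.eq]
  · rintro ⟨h1, h2⟩
    unfold IsCorner
    rw [h1, h2]

theorem isCorner_p (x : Fin k) : X.IsCorner x x (X.p x) :=
  isCorner_iff.2 ⟨(X.p_proj x).isIdempotentElem, (X.p_proj x).isIdempotentElem⟩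

theorem IsCorner.mul (ha : X.IsCorner x y a) (hb : X.IsCorner y z b) : X.IsCorner x z (a * b) := by
  rw [isCorner_iff] at *
  rw [← mul_assoc, ha.1, mul_assoc, hb.2]
  exact ⟨rfl, rfl⟩

theorem IsCorner.sub_smul (ha : X.IsCorner x y a) (hb : X.IsCorner x y b) (c : ℂ) :
    X.IsCorner x y (a - c • b) := by
  rw [isCorner_iff] at *
  rw [mul_sub, sub_mul, mul_smul_comm, smul_mul_assoc, ha.1, ha.2, hb.1, hb.2]
  exact ⟨rfl, rfl⟩

theorem IsCorner.p_mul_eq_zero (ha : X.IsCorner x y a) (hz : z ≠ x) : X.p z * a = 0 := by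
  rw [← (isCorner_iff.1 ha).1, ← mul_assoc, X.p_orthogonal z x hz, zero_mul]

theorem IsCorner.cornerTrace_eq (ha : X.IsCorner x y a) :
    X.cornerTrace a = (X.τ (X.p x))⁻¹ * X.τ a := by
  rw [cornerTrace_apply, Finset.sum_eq_single x]
  · rw [(isCorner_iff.1 ha).1]
  · intro j _ hj
    rw [ha.p_mul_eq_zero hj, map_zero, mul_zero]
  · simp

theorem IsCorner.τ_eq_zero (ha : X.IsCorner x y a) (h : x ≠ y) : X.τ a = 0 := by
  rw [← (isCorner_iff.1 ha).2, X.τ_comm, ha.p_mul_eq_zero h.symm, map_zero]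

theorem IsCorner.cornerTrace_eq' (ha : X.IsCorner x y a) :
    X.cornerTrace a = (X.τ (X.p y))⁻¹ * X.τ a := by
  rw [ha.cornerTrace_eq]
  rcases eq_or_ne x y with rfl | h
  · rfl
  · rw [ha.τ_eq_zero h, mul_zero, mul_zero]

theorem IsCorner.cornerTrace_eq_zero (ha : X.IsCorner x y a) (h : x ≠ y) : X.cornerTrace a = 0 := by
  rw [ha.cornerTrace_eq, ha.τ_eq_zero h, mul_zero]

theorem IsCorner.expect_eq (ha : X.IsCorner x y a) : X.expect a = X.cornerTrace a • X.p x := by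
  rw [ha.cornerTrace_eq, expect_apply, Finset.sum_eq_single x]
  · rw [(isCorner_iff.1 ha).1]
  · intro j _ hj
    rw [ha.p_mul_eq_zero hj, map_zero, mul_zero, zero_smul]
  · simp

theorem IsCorner.expect_eq' (ha : X.IsCorner x y a) : X.expect a = X.cornerTrace a • X.p y := by
  rcases eq_or_ne x y with rfl | h
  · exact ha.expect_eq
  · rw [ha.expect_eq, ha.cornerTrace_eq_zero h, zero_smul, zero_smul]

/-! ### Multiplicative extensions of the normalised trace -/

/-- The product over the blocks of `π` of the normalised traces of the block products. -/
noncomputable def moment (X : RectangularSpace A k) (π : NC n) (a : Fin n → A) : ℂ :=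
  ∏ V ∈ π.1.parts, X.cornerTrace (blockProd V a)

theorem moment_comap_predAbove (m : Fin n) (π : NC n) (a : Fin (n + 1) → A) :
    X.moment (NC.comap m.predAbove (Fin.predAbove_right_monotone m) π) a =
      X.moment π (contract m a) := by
  rw [moment, NC.prod_parts_comap, Finset.filter_true_of_mem, moment]
  · refine Finset.prod_congr rfl fun V _ => ?_
    rw [blockProd_contract]
  · intro V hV
    obtain ⟨b, hb⟩ := π.1.nonempty_of_mem_parts hV
    obtain ⟨a, rfl⟩ := Fin.predAbove_surjective (p := m) b
    exact ⟨a, hb⟩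

/-- Mismatched labels make the moment vanish. -/
theorem eq_of_moment_ne_zero {s e : Fin n → Fin k} {a : Fin n → A}
    (ha : ∀ i, X.IsCorner (s i) (e i) (a i)) {π : NC n} (h : X.moment π a ≠ 0) (i : Fin n) :
    e i = s (blockPerm π i) := by
  have hV := Finset.prod_ne_zero_iff.1 h _ (π.part_mem_parts i)
  by_contra hne
  apply hV
  obtain ⟨hr, ⟨hlt, hy⟩ | ⟨hle, hy⟩⟩ := NC.blockPerm_eq_iff.1 (rfl : blockPerm π i = blockPerm π i)
  -- Here the entries at i and at its successor are adjacent in the block product, with orthogonal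
  -- projections meeting between them.
  · rw [blockProd_split _ _ i,
      ← blockProd_mul (i := i) (V := {j ∈ π.1.part i | j ≤ i}) (Finset.mem_filter.2 ⟨NC.Rel.refl π i, le_rfl⟩) (by simp)
        (isCorner_iff.1 (ha i)).2,
      ← mul_blockProd (i := blockPerm π i) (V := {j ∈ π.1.part i | i < j})
        (Finset.mem_filter.2 ⟨hr, hlt⟩) (fun j hj => ?_) (isCorner_iff.1 (ha _)).1,
      mul_assoc, ← mul_assoc (X.p _), X.p_orthogonal _ _ hne, zero_mul, mul_zero, map_zero]
    obtain ⟨h1, h2⟩ := Finset.mem_filter.1 hj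
    exact (hy j h1).resolve_left h2.not_ge
  -- Here i is the maximum of its block and its successor the minimum, so the block product lies in
  -- an off-diagonal corner.
  · refine IsCorner.cornerTrace_eq_zero (isCorner_iff.2 ⟨?_, ?_⟩) (Ne.symm hne)
    · exact mul_blockProd hr (fun j hj => (hy j hj).1) (isCorner_iff.1 (ha _)).1
    · exact blockProd_mul (NC.Rel.refl π i) (fun j hj => (hy j hj).2) (isCorner_iff.1 (ha _)).2

/-- The partition obtained by deleting the point `j`. -/
noncomputable abbrev _root_.RectangularProbability.NC.erase (j : Fin (n + 1)) (π : NC (n + 1)) :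
    NC n :=
  NC.comap j.succAbove (Fin.strictMono_succAbove j).monotone π

theorem _root_.RectangularProbability.NC.blockPerm_erase {j : Fin (n + 1)} {π : NC (n + 1)}
    {a b : Fin n} (h : blockPerm π (j.succAbove a) = j.succAbove b ∨
      (blockPerm π (j.succAbove a) = j ∧ blockPerm π j = j.succAbove b)) :
    blockPerm (NC.erase j π) a = b := by
  have hlt : ∀ x y, x < y ↔ j.succAbove x < j.succAbove y :=
    fun x y => (Fin.strictMono_succAbove j).lt_iff_lt.symm
  have hle : ∀ x y, x ≤ y ↔ j.succAbove x ≤ j.succAbove y :=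
    fun x y => (Fin.strictMono_succAbove j).le_iff_le.symm
  have hne : ∀ x, j.succAbove x ≠ j := Fin.succAbove_ne j
  have ha := hne a
  have hb := hne b
  simp only [NC.blockPerm_eq_iff, NC.comap_rel, hlt, hle] at *
  generalize j.succAbove a = a' at *
  generalize j.succAbove b = b' at *
  rcases h with ⟨h1, h2⟩ | ⟨⟨h1, h2⟩, h3, h4⟩
  · exact ⟨h1, h2.imp (fun h => ⟨h.1, fun y => h.2 _⟩) (fun h => ⟨h.1, fun y => h.2 _⟩)⟩
  · refine ⟨h1.trans h3, ?_⟩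
    have h5 : ∀ y, π.Rel a' y → π.Rel j y := fun y hy => h1.symm.trans hy
    have ha' := h5 a' (NC.Rel.refl π a')
    have hb' := h1.trans h3
    rcases h2 with ⟨h2, h2'⟩ | ⟨h2, h2'⟩ <;> rcases h4 with ⟨h4, h4'⟩ | ⟨h4, h4'⟩
    · refine Or.inl ⟨h2.trans h4, fun y hy => ?_⟩
      have := h2' _ hy
      have := h4' _ (h5 _ hy)
      have := hne y
      grind
    · refine Or.inr ⟨?_, fun y hy => ?_⟩
      · have := h4' _ ha'
        grind
      · have := h2' _ hy
        have := h4' _ (h5 _ hy)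
        have := hne y
        grind
    · refine Or.inr ⟨?_, fun y hy => ?_⟩
      · have := h4' _ ha'
        have := h2' _ hb'
        grind
      · have := h2' _ hy
        have := h4' _ (h5 _ hy)
        have := hne y
        grind
    · have := h4' _ ha'
      have := h2' _ hb'
      grind

/-- Deleting a unit `X.p x` at position `j` does not change the moment. The labels on the two sides
of `j` agree automatically as soon as the labels balance over some set of points separating them. -/
theorem moment_erase {π : NC (n + 1)} {j : Fin (n + 1)} {s e : Fin (n + 1) → Fin k}
    {a : Fin (n + 1) → A} (ha : ∀ i, X.IsCorner (s i) (e i) (a i)) (hj : s j = e j)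
    (haj : a j = X.p (e j)) (Z : Finset (Fin (n + 1)))
    (hZ : ∀ i, i ≠ j → blockPerm π i = j → i ∈ Z ∧ j ∉ Z)
    (hsum : ∑ z ∈ Z, (e z).val = ∑ z ∈ Z, (s (blockPerm π z)).val) :
    X.moment π a = X.moment (NC.erase j π) fun i => a (j.succAbove i) := by
  have hnot : ∀ V : Finset (Fin (n + 1)), j ∉ V → blockProd V a =
      blockProd {i | j.succAbove i ∈ V} fun i => a (j.succAbove i) :=
    fun V hV => blockProd_succAbove V a j fun h => absurd h hV
  have hupd : ∀ V : Finset (Fin (n + 1)), blockProd V (Function.update a j 1) =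
      blockProd {i | j.succAbove i ∈ V} fun i => a (j.succAbove i) := by
    intro V
    rw [blockProd_succAbove V _ j (by simp)]
    simp [Fin.succAbove_ne]
  obtain ⟨i, hi⟩ := (NC.blockPerm_bijective π).2 j
  -- A singleton block {j} contributes φ(p) = 1; this is where the normalisation of the trace
  -- matters.
  rcases eq_or_ne i j with rfl | hij
  · have hpart : π.1.part i = {i} := by
      obtain ⟨h1, h2⟩ := NC.blockPerm_eq_iff.1 hi
      ext y
      rw [Finset.mem_singleton]
      constructor
      · intro hy
        have := h2.elim (fun h => absurd h.1 (lt_irrefl _)) (fun h => h.2 y hy)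
        exact le_antisymm this.2 this.1
      · rintro rfl
        exact NC.Rel.refl π y
    rw [moment, moment, NC.prod_parts_comap, Finset.prod_filter]
    refine Finset.prod_congr rfl fun V hV => ?_
    by_cases hiV : i ∈ V
    · obtain rfl : V = {i} := by rw [← hpart, π.1.part_eq_of_mem hV hiV]
      rw [if_neg (by simp [Fin.succAbove_ne]), blockProd_singleton, haj, cornerTrace_p]
    · rw [if_pos, hnot V hiV]
      obtain ⟨y, hy⟩ := π.1.nonempty_of_mem_parts hV
      obtain ⟨z, rfl⟩ := Fin.exists_succAbove_eq (x := y) (y := i) fun h => hiV (h ▸ hy)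
      exact ⟨z, hy⟩
  obtain ⟨hiZ, hjZ⟩ := hZ i hij hi
  obtain ⟨i', rfl⟩ := Fin.exists_succAbove_eq hij
  have hbj : blockPerm π j ≠ j := fun h => hij (NC.blockPerm_injective π (hi.trans h.symm))
  obtain ⟨b', hb'⟩ := Fin.exists_succAbove_eq hbj
  -- If the labels on both sides of j match, the projection is absorbed by its predecessor, or by
  -- its successor when j is the minimum of its block.
  by_cases hcomp : e (j.succAbove i') = s j ∧ e j = s (blockPerm π j)
  · rw [moment, moment, NC.prod_parts_comap, Finset.filter_true_of_mem]
    · refine Finset.prod_congr rfl fun V hV => ?_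
      by_cases hjV : j ∈ V
      · rw [← hupd]
        obtain rfl : V = π.1.part j := (π.1.part_eq_of_mem hV hjV).symm
        obtain ⟨hr, hy⟩ := NC.blockPerm_eq_iff.1 hi
        generalize j.succAbove i' = i at *
        rcases hy with ⟨hlt, hy⟩ | ⟨hle, hy⟩
        · rw [blockProd_split _ _ i, blockProd_split _ (Function.update a j 1) i]
          have h1 : blockProd {y ∈ π.1.part j | y ≤ i} (Function.update a j 1) =
              blockProd {y ∈ π.1.part j | y ≤ i} a := by
            refine blockProd_congr fun y hy => Function.update_of_ne ?_ _ _
            rintro rfl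
            exact (Finset.mem_filter.1 hy).2.not_gt hlt
          rw [h1, blockProd_pull_left (V := {y ∈ π.1.part j | i < y}) (i := j) a
            (Finset.mem_filter.2 ⟨NC.Rel.refl π j, hlt⟩), ← mul_assoc, blockProd_mul (i := i)]
          · exact Finset.mem_filter.2 ⟨hr.symm, le_rfl⟩
          · simp
          · rw [haj, ← hj, ← hcomp.1]
            exact (isCorner_iff.1 (ha i)).2
          · intro y hy'
            obtain ⟨h1, h2⟩ := Finset.mem_filter.1 hy'
            exact (hy y (hr.trans h1)).resolve_left h2.not_ge
        · obtain ⟨hr', hy'⟩ := NC.blockPerm_eq_iff.1 (rfl : blockPerm π j = blockPerm π j)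
          have h1 : blockProd {y ∈ π.1.part j | y ≤ j} (Function.update a j 1) = 1 := by
            have : ({y ∈ π.1.part j | y ≤ j} : Finset _) = {j} := by
              ext y
              rw [Finset.mem_filter, Finset.mem_singleton]
              constructor
              · exact fun h => le_antisymm h.2 (hy y (hr.trans h.1)).1
              · rintro rfl
                exact ⟨NC.Rel.refl π y, le_rfl⟩
            rw [this, blockProd_singleton, Function.update_self]
          have hlt : j < blockPerm π j :=
            lt_of_le_of_ne (hy _ (hr.trans hr')).1 (Ne.symm hbj)
          rw [blockProd_pull_left (i := j) a (NC.Rel.refl π j) fun y h => (hy y (hr.trans h)).1,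
            blockProd_split _ (Function.update a j 1) j, h1, one_mul,
            mul_blockProd (i := blockPerm π j) (Finset.mem_filter.2 ⟨hr', hlt⟩)]
          · intro y h
            obtain ⟨h2, h3⟩ := Finset.mem_filter.1 h
            rcases hy' with hy' | hy'
            · exact (hy'.2 y h2).resolve_left h3.not_ge
            · exact absurd hy'.1 hlt.not_ge
          · rw [Function.update_of_ne hbj, haj, hcomp.2]
            exact (isCorner_iff.1 (ha _)).1
      · rw [hnot V hjV]
    · intro V hV
      by_cases hjV : j ∈ V
      · refine ⟨i', ?_⟩
        rw [← π.1.part_eq_of_mem hV hjV]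
        have := NC.rel_blockPerm π (j.succAbove i')
        rw [hi] at this
        exact this.symm
      · obtain ⟨y, hy⟩ := π.1.nonempty_of_mem_parts hV
        obtain ⟨z, rfl⟩ := Fin.exists_succAbove_eq (x := y) (y := j) fun h => hjV (h ▸ hy)
        exact ⟨z, hy⟩
  · have h1 : X.moment π a = 0 := by
      by_contra h
      have h1 := eq_of_moment_ne_zero ha h
      exact hcomp ⟨by rw [h1, hi], h1 j⟩
    rw [h1]
    by_contra h
    have h2 := eq_of_moment_ne_zero (s := fun i => s (j.succAbove i))
      (e := fun i => e (j.succAbove i)) (fun i => ha _) (Ne.symm h)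
    have h3 := h2 i'
    rw [NC.blockPerm_erase (Or.inr ⟨hi, hb'.symm⟩), hb'] at h3
    -- Off the predecessor of j, all labels over Z match, so equality of the label sums (taken in ℕ,
    -- where one may cancel) forces the match at the predecessor. The shortcut past j then gives the
    -- match after j, a contradiction.
    have h4 : ∀ z ∈ Z, z ≠ j.succAbove i' → (e z).val = (s (blockPerm π z)).val := by
      intro z hz hne
      have hzj : z ≠ j := by rintro rfl; exact hjZ hz
      obtain ⟨z', rfl⟩ := Fin.exists_succAbove_eq hzj
      have hw : blockPerm π (j.succAbove z') ≠ j :=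
        fun h => hne (NC.blockPerm_injective π (h.trans hi.symm))
      obtain ⟨w', hw'⟩ := Fin.exists_succAbove_eq hw
      have := h2 z'
      rw [NC.blockPerm_erase (Or.inl hw'.symm), hw'] at this
      rw [this]
    rw [← Finset.add_sum_erase _ _ hiZ, ← Finset.add_sum_erase _ _ hiZ, hi,
      Finset.sum_congr rfl fun z hz => h4 z (Finset.mem_of_mem_erase hz) (Finset.ne_of_mem_erase hz)]
      at hsum
    have h5 : e (j.succAbove i') = s j := Fin.ext (Nat.add_right_cancel hsum)
    exact hcomp ⟨h5, by rw [← h3, h5, hj]⟩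

end RectangularSpace
end RectangularProbability

/-! ### Shortening the word and the mixed sum -/

namespace RectangularProbability

theorem gc_predAbove_succAbove {n : ℕ} (m : Fin n) :
    GaloisConnection m.predAbove m.castSucc.succAbove := by
  intro x i
  simp only [Fin.predAbove, Fin.succAbove, Fin.lt_def, Fin.le_def, Fin.val_castSucc]
  split_ifs <;> simp only [Fin.val_pred, Fin.coe_castPred, Fin.val_succ, Fin.val_castSucc] <;> omega

theorem gc_succAbove_predAbove {n : ℕ} (m : Fin n) :
    GaloisConnection m.succ.succAbove m.predAbove := by
  intro x i
  simp only [Fin.predAbove, Fin.succAbove, Fin.lt_def, Fin.le_def, Fin.val_castSucc, Fin.val_succ]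
  split_ifs <;> simp only [Fin.val_pred, Fin.coe_castPred, Fin.val_succ, Fin.val_castSucc] <;> omega

/-- Both shortenings drop the right label of C_m and the left label of D_{m+1}; the remaining labels
stay cyclically matched. -/
theorem succAbove_add_one {n : ℕ} (m i : Fin (n + 1)) :
    m.castSucc.succAbove i + 1 = m.succ.succAbove (i + 1) := by
  ext
  simp only [Fin.succAbove, Fin.lt_def, Fin.val_castSucc, Fin.val_succ]
  split_ifs <;> simp only [Fin.val_add_one, Fin.ext_iff, Fin.val_succ, Fin.val_castSucc,
    Fin.val_last] at * <;> grind

theorem contract_mul {R : Type*} [Monoid R] {n : ℕ} (m : Fin n) (D C : Fin (n + 1) → R)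
    (h : D m.castSucc * C m.castSucc = D m.castSucc) :
    contract m (fun i => D i * C i) = fun i => contract m D i * C (m.castSucc.succAbove i) := by
  funext i
  unfold contract
  rcases lt_trichotomy i m with hi | rfl | hi
  · simp [hi, Fin.succAbove_of_castSucc_lt]
  · simp [h, mul_assoc]
  · simp [hi.not_gt, hi.ne', Fin.succAbove_of_le_castSucc, hi.le]

theorem contract_mul' {R : Type*} [Monoid R] {n : ℕ} (m : Fin n) (D C : Fin (n + 1) → R)
    (h : C m.castSucc * D m.succ = C m.castSucc) :
    contract m (fun i => D i * C i) = fun i => D (m.succ.succAbove i) * contract m C i := by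
  funext i
  unfold contract
  rcases lt_trichotomy i m with hi | rfl | hi
  · simp [hi, Fin.succAbove_of_castSucc_lt, Fin.castSucc_lt_succ_iff, hi.le]
  · simp only [lt_irrefl, if_false, if_true, Fin.succAbove_succ_self]
    rw [mul_assoc, ← mul_assoc (C _), h]
  · simp [hi.not_gt, hi.ne', Fin.succAbove_of_le_castSucc, Fin.succ_le_castSucc_iff, hi]

theorem sum_filter_comp_of_bijective {α β : Type*} [Fintype α] [AddCommMonoid β] {f : α → α}
    (hf : f.Bijective) (P Q : α → Prop) [DecidablePred P] [DecidablePred Q]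
    (h : ∀ a, P a ↔ Q (f a)) (g : α → β) : ∑ a with P a, g (f a) = ∑ a with Q a, g a := by
  rw [Finset.sum_filter, Finset.sum_filter, ← hf.sum_comp fun a => if Q a then g a else 0]
  simp only [h]

namespace RectangularSpace

variable {A : Type*} [CStarAlgebra A] [PartialOrder A] [StarOrderedRing A] [WStarAlgebra A]
  {k n : ℕ} {X : RectangularSpace A k}

theorem isCorner_contract {s e : Fin (n + 1) → Fin k} {a : Fin (n + 1) → A}
    (ha : ∀ i, X.IsCorner (s i) (e i) (a i)) (m : Fin n) (h : e m.castSucc = s m.succ) (i : Fin n) :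
    X.IsCorner (s (m.succ.succAbove i)) (e (m.castSucc.succAbove i)) (contract m a i) := by
  unfold contract
  rcases lt_trichotomy i m with hi | rfl | hi
  · simpa [hi, Fin.succAbove_of_castSucc_lt, Fin.castSucc_lt_succ_iff, hi.le] using ha i.castSucc
  · simpa using (ha i.castSucc).mul (h ▸ ha i.succ)
  · simpa [hi.not_gt, hi.ne', Fin.succAbove_of_le_castSucc, Fin.succ_le_castSucc_iff, hi, hi.le]
      using ha i.succ

open Classical in
/-- The sum `∑ κ_π[D] φ_{K(π)}[C]` of cumulants of `D` and moments of `C`. -/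
noncomputable def mixedSum (X : RectangularSpace A k) (D C : Fin n → A) : ℂ :=
  ∑ σ, ∑ π, X.moment σ D * X.moment (kreweras π) C * ncMu σ π

/-- Merging D_m and D_{m+1} pulls σ back along `predAbove`; applying the left adjoint to π deletes
the point m from K(π). Rota's theorem lifts the short sum to the large lattice, where `moment_erase`
applies. -/
theorem mixedSum_erase_right {r r' q : Fin (n + 1) → Fin k} {D C : Fin (n + 1) → A}
    (hq : ∀ i, q i = r (i + 1)) (hD : ∀ i, X.IsCorner (r i) (r' i) (D i))
    (hC : ∀ i, X.IsCorner (r' i) (q i) (C i)) (m : Fin n) (hm : r' m.castSucc = q m.castSucc)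
    (hCm : C m.castSucc = X.p (q m.castSucc)) :
    X.mixedSum D C = X.mixedSum (contract m D) fun i => C (m.castSucc.succAbove i) := by
  classical
  symm
  have hgc := gc_predAbove_succAbove m
  unfold mixedSum
  simp_rw [← moment_comap_predAbove]
  rw [sum_mul_ncMu_galois (NC.gc_map_comap _ hgc.monotone_l) (fun σ => X.moment σ D)
    (fun π => X.moment (kreweras π) fun i => C (m.castSucc.succAbove i))]
  refine Finset.sum_congr rfl fun σ _ => Finset.sum_congr rfl fun π _ => ?_
  by_cases hσπ : σ ≤ π
  swap
  · rw [ncMu_eq_zero hσπ, mul_zero, mul_zero]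
  by_cases hσ : X.moment σ D = 0
  · simp only [hσ, zero_mul]
  -- Since π ∘ K(π) is z ↦ z + 1, this set contains the K(π)-predecessor of m, and K(π) maps it onto
  -- the π-block of m.
  rw [NC.kreweras_map hgc, moment_erase hC hm hCm {z | π.Rel m.castSucc (z + 1)}]
  · intro i hi hKi
    have h1 := NC.blockPerm_kreweras π i
    rw [hKi] at h1
    refine ⟨Finset.mem_filter.2 ⟨Finset.mem_univ _, h1 ▸ NC.rel_blockPerm π _⟩, fun h2 => ?_⟩
    have h3 := (Finset.mem_filter.1 h2).2
    have h4 := NC.rel_blockPerm (kreweras π) i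
    rw [hKi] at h4
    have h5 := NC.sep_rel.1 (NC.le_iff.1 (NC.kreweras_rel.1 h4) _ _ h3)
    rw [Fin.coeSucc_eq_succ] at h5
    simp only [Fin.le_def, Fin.val_succ, Fin.val_castSucc, ne_eq, Fin.ext_iff] at h5 hi
    omega
  -- Both label sums equal the sum of r over the π-block of m: σ ≤ π permutes that block, and r' = r
  -- ∘ σ because the moment of D is nonzero.
  · have hc := eq_of_moment_ne_zero hD hσ
    have hadd : Function.Bijective fun z : Fin (n + 1) => z + 1 :=
      (Equiv.addRight (1 : Fin (n + 1))).bijective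
    simp_rw [hq]
    rw [sum_filter_comp_of_bijective hadd _ (fun z => π.Rel m.castSucc z) (fun _ => Iff.rfl)
        (fun z => (r z).val),
      sum_filter_comp_of_bijective (NC.blockPerm_bijective (kreweras π)) _
        (fun z => π.Rel m.castSucc z) (fun a => ?_) (fun z => (r' z).val)]
    · simp_rw [hc]
      rw [sum_filter_comp_of_bijective (NC.blockPerm_bijective σ) _
        (fun z => π.Rel m.castSucc z) (fun a => ?_) (fun z => (r z).val)]
      have := NC.le_iff.1 hσπ _ _ (NC.rel_blockPerm σ a)
      exact ⟨fun h => h.trans this, fun h => h.trans this.symm⟩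
    · rw [← NC.blockPerm_kreweras π a]
      have := NC.rel_blockPerm π (blockPerm (kreweras π) a)
      exact ⟨fun h => h.trans this.symm, fun h => h.trans this⟩

/-- The roles are exchanged: deleting D_{m+1} deletes a point of σ, merging C_m and C_{m+1} pulls
K(π) back, and the nonzero moment of C balances the labels over a block of K(σ). -/
theorem mixedSum_erase_left {r r' q : Fin (n + 1) → Fin k} {D C : Fin (n + 1) → A}
    (hq : ∀ i, q i = r (i + 1)) (hD : ∀ i, X.IsCorner (r i) (r' i) (D i))
    (hC : ∀ i, X.IsCorner (r' i) (q i) (C i)) (m : Fin n) (hm : r m.succ = r' m.succ)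
    (hDm : D m.succ = X.p (r' m.succ)) :
    X.mixedSum D C = X.mixedSum (fun i => D (m.succ.succAbove i)) (contract m C) := by
  classical
  symm
  have hgc := gc_succAbove_predAbove m
  unfold mixedSum
  simp_rw [← moment_comap_predAbove, ← NC.kreweras_map hgc]
  rw [← sum_mul_ncMu_galois (NC.gc_map_comap _ hgc.monotone_l)
    (fun σ => X.moment σ fun i => D (m.succ.succAbove i)) (fun π => X.moment (kreweras π) C)]
  refine Finset.sum_congr rfl fun σ _ => Finset.sum_congr rfl fun π _ => ?_
  by_cases hσπ : σ ≤ π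
  swap
  · rw [ncMu_eq_zero hσπ, mul_zero, mul_zero]
  by_cases hπ : X.moment (kreweras π) C = 0
  · rw [hπ, mul_zero, mul_zero]
  rw [moment_erase hD hm hDm {z | (kreweras σ).Rel m.castSucc z}]
  · intro i hi hσi
    have h1 := NC.blockPerm_kreweras σ m.castSucc
    rw [Fin.coeSucc_eq_succ, ← hσi] at h1
    have h2 := NC.blockPerm_injective σ h1
    refine ⟨Finset.mem_filter.2 ⟨Finset.mem_univ _, h2 ▸ NC.rel_blockPerm _ _⟩, fun h3 => ?_⟩
    have h4 := NC.rel_blockPerm σ i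
    rw [hσi] at h4
    have h5 := NC.sep_rel.1 (NC.le_iff.1 (NC.kreweras_rel.1 (Finset.mem_filter.1 h3).2) _ _ h4)
    simp only [Fin.le_def, Fin.val_succ, Fin.val_castSucc, ne_eq, Fin.ext_iff] at h5 hi
    omega
  -- On the K(σ)-block of m, which K(π) ≤ K(σ) permutes, r' has the same sum as r' ∘ K(π). The
  -- latter is z ↦ r(z + 1) = r(σ(K(σ)(z))), and K(σ) permutes the block too.
  · have hc := eq_of_moment_ne_zero hC hπ
    rw [← sum_filter_comp_of_bijective (NC.blockPerm_bijective (kreweras π))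
        (fun z => (kreweras σ).Rel m.castSucc z) _ (fun a => ?_) (fun z => (r' z).val),
      ← sum_filter_comp_of_bijective (NC.blockPerm_bijective (kreweras σ))
        (fun z => (kreweras σ).Rel m.castSucc z) _ (fun a => ?_)
        (fun z => (r (blockPerm σ z)).val)]
    · simp_rw [← hc, hq, NC.blockPerm_kreweras]
    · have := NC.rel_blockPerm (kreweras σ) a
      exact ⟨fun h => h.trans this, fun h => h.trans this.symm⟩
    · have := NC.le_iff.1 (NC.kreweras_antitone hσπ) _ _ (NC.rel_blockPerm (kreweras π) a)
      exact ⟨fun h => h.trans this, fun h => h.trans this.symm⟩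

/-! ### Vanishing of the mixed sum on centred words -/

theorem moment_eq_zero_of_singleton {π : NC n} {a : Fin n → A} {i : Fin n}
    (hi : ∀ j, π.Rel i j → j = i) (ha : X.cornerTrace (a i) = 0) : X.moment π a = 0 := by
  refine Finset.prod_eq_zero (π.part_mem_parts i) ?_
  have : π.1.part i = {i} := by
    ext j
    rw [Finset.mem_singleton]
    exact ⟨hi j, fun h => h ▸ NC.Rel.refl π i⟩
  rw [this, blockProd_singleton, ha]

/-- A partition of `{0, …, n}`, `n ≥ 1`, whose blocks other than that of `0` are not singletons
contains two neighbours in one block. -/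
theorem _root_.RectangularProbability.NC.exists_rel_succ {σ : NC (n + 2)}
    (h : ∀ i, i ≠ 0 → ∃ j, σ.Rel i j ∧ j ≠ i) : ∃ m : Fin (n + 1), σ.Rel m.castSucc m.succ := by
  -- Take the least b with a smaller point a in its block; strictly below b no two points are
  -- related.
  have hex : ∃ b : ℕ, ∃ a b' : Fin (n + 2), b'.val = b ∧ a < b' ∧ σ.Rel a b' := by
    obtain ⟨j, hj, hne⟩ := h 1 (by simp)
    rcases lt_or_gt_of_ne hne with hlt | hlt
    · exact ⟨_, j, 1, rfl, hlt, hj.symm⟩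
    · exact ⟨_, 1, j, rfl, hlt, hj⟩
  classical
  obtain ⟨a, b, hb, hab, hr⟩ := Nat.find_spec hex
  have hmin : ∀ c d : Fin (n + 2), c < d → d < b → ¬ σ.Rel c d := by
    intro c d hcd hdb hr'
    exact Nat.find_min hex (hb ▸ hdb) ⟨c, d, rfl, hcd, hr'⟩
  clear hb
  have ha : a.val < n + 1 := by have := b.2; simp only [Fin.lt_def] at hab; omega
  obtain ⟨a, rfl⟩ : ∃ m : Fin (n + 1), a = m.castSucc := ⟨⟨a, ha⟩, rfl⟩
  refine ⟨a, ?_⟩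
  rcases (Fin.castSucc_lt_iff_succ_le.1 hab).eq_or_lt with rfl | hlt
  · exact hr
  -- By minimality the partner c of a + 1 is not below b. So c is b itself, or lies beyond b and
  -- non-crossing joins a to a + 1.
  obtain ⟨c, hc, hne⟩ := h a.succ (Fin.succ_ne_zero a)
  rcases lt_or_gt_of_ne hne with hlt' | hlt'
  · exact absurd hc.symm (hmin _ _ hlt' hlt)
  · rcases lt_trichotomy c b with hcb | rfl | hcb
    · exact absurd hc (hmin _ _ hlt' hcb)
    · exact hr.trans hc.symm
    · exact NC.Rel.of_lt σ Fin.castSucc_lt_succ hlt hcb hr hc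

theorem mixedSum_eq_zero {D C : Fin (n + 2) → A} (hD : ∀ i, i ≠ 0 → X.cornerTrace (D i) = 0)
    (hC : ∀ i, i ≠ Fin.last _ → X.cornerTrace (C i) = 0) : X.mixedSum D C = 0 := by
  refine Finset.sum_eq_zero fun σ _ => Finset.sum_eq_zero fun π _ => ?_
  by_cases hσπ : σ ≤ π
  swap
  · rw [ncMu_eq_zero hσπ, mul_zero]
  by_cases h : ∃ i, i ≠ 0 ∧ ∀ j, σ.Rel i j → j = i
  · obtain ⟨i, hi, hj⟩ := h
    rw [moment_eq_zero_of_singleton hj (hD i hi), zero_mul, zero_mul]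
  · push Not at h
    obtain ⟨m, hm⟩ := NC.exists_rel_succ h
    -- As π joins m and m + 1, any cut at the barred point m other than the trivial one separates
    -- them.
    rw [moment_eq_zero_of_singleton (π := kreweras π) (i := m.castSucc) _
      (hC _ (Fin.castSucc_lt_last m).ne), mul_zero, zero_mul]
    intro j hj
    have := NC.sep_rel.1 (NC.le_iff.1 (NC.kreweras_rel.1 hj) _ _ (NC.le_iff.1 hσπ _ _ hm))
    simp only [Fin.le_def, Fin.val_succ, Fin.val_castSucc, Fin.ext_iff] at this ⊢
    omega

end RectangularSpace
end RectangularProbability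

namespace RectangularProbability

/-! ### Freeness and alternating products -/

section Freeness

variable {A : Type*} {n : ℕ}

theorem IsFreeOver.list_prod [Ring A] [Algebra ℂ A] {B : Subalgebra ℂ A} {F : A →ₗ[ℂ] A} {ι : Type*}
    {𝒜 : ι → Subalgebra ℂ A} (h : IsFreeOver B F 𝒜) {L : List (ι × A)} (hL : L ≠ [])
    (hmem : ∀ x ∈ L, x.2 ∈ 𝒜 x.1 ∧ F x.2 = 0) (hchain : L.IsChain fun x y => x.1 ≠ y.1) :
    F (L.map Prod.snd).prod = 0 := by
  obtain ⟨x, L, rfl⟩ := List.exists_cons_of_ne_nil hL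
  have := h.2 L.length (fun j => ((x :: L).get j).1) (fun j => ((x :: L).get j).2)
    (fun j => (hmem _ (List.get_mem _ _)).1) (fun j => (hmem _ (List.get_mem _ _)).2)
    (fun j => (List.isChain_iff_getElem.1 hchain) j (by simp))
  rw [← this]
  congr 2
  refine List.ext_getElem (by simp) fun i h1 h2 => ?_
  simp

/-- The list `g 0, f 0, g 1, f 1, …`. -/
def alternating {n : ℕ} (g f : Fin n → A) : List (Fin 2 × A) :=
  (List.ofFn fun i => [((0 : Fin 2), g i), ((1 : Fin 2), f i)]).flatten

theorem alternating_succ (g f : Fin (n + 1) → A) : alternating g f =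
    (0, g 0) :: (1, f 0) :: alternating (fun i => g i.succ) fun i => f i.succ := by
  simp [alternating, List.ofFn_succ]

theorem mem_alternating {g f : Fin n → A} {x : Fin 2 × A} (hx : x ∈ alternating g f) :
    ∃ i, x = (0, g i) ∨ x = (1, f i) := by
  obtain ⟨l, hl, hx⟩ := List.mem_flatten.1 hx
  obtain ⟨i, rfl⟩ := List.mem_ofFn.1 hl
  exact ⟨i, by simpa using hx⟩

theorem isChain_alternating (g f : Fin n → A) (a b : A) :
    ((1, a) :: (alternating g f ++ [(0, b)])).IsChain fun x y => x.1 ≠ y.1 := by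
  induction n generalizing a with
  | zero => simp [alternating]
  | succ n ih =>
    rw [alternating_succ, List.cons_append, List.cons_append]
    exact List.isChain_cons_cons.2 ⟨by simp, List.isChain_cons_cons.2 ⟨by simp, ih _ _ _⟩⟩

/-- The two outer letters are set aside because they need not be centred. -/
theorem prod_ofFn_mul [Ring A] (f g : Fin (n + 1) → A) : (List.ofFn fun i => f i * g i).prod =
    f 0 * ((alternating (fun i : Fin n => g i.castSucc) fun i => f i.succ).map Prod.snd).prod *
      g (Fin.last n) := by
  induction n with
  | zero => simp [alternating]
  | succ n ih =>
    rw [List.ofFn_succ, List.prod_cons, ih, alternating_succ]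
    simp only [List.map_cons, List.prod_cons, mul_assoc]
    rfl

end Freeness

/-! ### Multilinearity of both sides -/

section

variable {A : Type*} [Ring A] [Algebra ℂ A] {n : ℕ}

theorem prod_ofFn_update (f : Fin n → A) (j : Fin n) (u v : A) (z : ℂ) :
    (List.ofFn (Function.update f j (u + z • v))).prod =
      (List.ofFn (Function.update f j u)).prod + z • (List.ofFn (Function.update f j v)).prod := by
  have h := (MultilinearMap.mkPiAlgebraFin ℂ n A).map_update_add f j u (z • v)
  rw [MultilinearMap.map_update_smul] at h
  simpa only [MultilinearMap.mkPiAlgebraFin_apply] using h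

theorem blockProd_update (V : Finset (Fin n)) (f : Fin n → A) {j : Fin n} (hj : j ∈ V) (u v : A)
    (z : ℂ) : blockProd V (Function.update f j (u + z • v)) =
      blockProd V (Function.update f j u) + z • blockProd V (Function.update f j v) := by
  have h : ∀ w, blockProd V (Function.update f j w) =
      (List.ofFn (Function.update (fun i => if i ∈ V then f i else 1) j w)).prod := by
    intro w
    unfold blockProd
    congr 2
    funext i
    rcases eq_or_ne i j with rfl | hi
    · simp [hj]
    · simp [hi]
  rw [h, h, h, prod_ofFn_update]

end

namespace RectangularSpace

variable {A : Type*} [CStarAlgebra A] [PartialOrder A] [StarOrderedRing A] [WStarAlgebra A]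
  {k n : ℕ} {X : RectangularSpace A k}

/-- Only the block containing j sees the entry at j. -/
theorem moment_update (π : NC n) (f : Fin n → A) (j : Fin n) (u v : A) (z : ℂ) :
    X.moment π (Function.update f j (u + z • v)) =
      X.moment π (Function.update f j u) + z * X.moment π (Function.update f j v) := by
  unfold moment
  have hrest : ∀ w, ∏ V ∈ π.1.parts.erase (π.1.part j),
      X.cornerTrace (blockProd V (Function.update f j w)) =
      ∏ V ∈ π.1.parts.erase (π.1.part j), X.cornerTrace (blockProd V f) := by
    intro w
    refine Finset.prod_congr rfl fun V hV => ?_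
    obtain ⟨h1, h2⟩ := Finset.mem_erase.1 hV
    rw [blockProd_congr (a := Function.update f j w) (b := f) fun i hi => Function.update_of_ne ?_ _ _]
    rintro rfl
    exact h1 (π.1.part_eq_of_mem h2 hi).symm
  simp only [← Finset.mul_prod_erase _ _ (π.part_mem_parts j), hrest]
  rw [blockProd_update _ _ (NC.Rel.refl π j), map_add, map_smul, smul_eq_mul, add_mul, mul_assoc]

/-- The difference of the two sides of the moment formula. -/
noncomputable def defect (X : RectangularSpace A k) (D C : Fin n → A) : ℂ :=
  X.cornerTrace (List.ofFn fun i => D i * C i).prod - X.mixedSum D C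

theorem defect_update_left (D C : Fin n → A) (j : Fin n) (u v : A) (z : ℂ) :
    X.defect (Function.update D j (u + z • v)) C =
      X.defect (Function.update D j u) C + z * X.defect (Function.update D j v) C := by
  have h : ∀ w, (fun i => Function.update D j w i * C i) =
      Function.update (fun i => D i * C i) j (w * C j) := by
    intro w
    funext i
    rcases eq_or_ne i j with rfl | hi
    · simp
    · simp [hi]
  unfold defect mixedSum
  simp only [h, moment_update, add_mul, smul_mul_assoc, prod_ofFn_update, map_add, map_smul,
    smul_eq_mul, Finset.sum_add_distrib, mul_sub, Finset.mul_sum, mul_assoc]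
  ring

theorem defect_update_right (D C : Fin n → A) (j : Fin n) (u v : A) (z : ℂ) :
    X.defect D (Function.update C j (u + z • v)) =
      X.defect D (Function.update C j u) + z * X.defect D (Function.update C j v) := by
  have h : ∀ w, (fun i => D i * Function.update C j w i) =
      Function.update (fun i => D i * C i) j (D j * w) := by
    intro w
    funext i
    rcases eq_or_ne i j with rfl | hi
    · simp
    · simp [hi]
  unfold defect mixedSum
  simp only [h, moment_update, add_mul, mul_add, mul_smul_comm, prod_ofFn_update, map_add, map_smul,
    smul_eq_mul, Finset.sum_add_distrib, mul_sub, Finset.mul_sum]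
  simp only [mul_assoc, mul_left_comm]
  ring

/-! ### The moment formula -/

theorem p_mem_diag (X : RectangularSpace A k) (i : Fin k) : X.p i ∈ X.diag :=
  Algebra.subset_adjoin ⟨i, rfl⟩

theorem expect_diag_mul {b : A} (hb : b ∈ X.diag) (a : A) : X.expect (b * a) = b * X.expect a := by
  simpa using X.expect_isConditionalExpectation.map_bimodule b hb 1 (one_mem _) a

theorem expect_mul_diag {b : A} (hb : b ∈ X.diag) (a : A) : X.expect (a * b) = X.expect a * b := by
  simpa using X.expect_isConditionalExpectation.map_bimodule 1 (one_mem _) b hb a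

theorem expect_p (i : Fin k) : X.expect (X.p i) = X.p i := by
  rw [(isCorner_p i).expect_eq, cornerTrace_p, one_smul]

/-- The `F`-centred part of an element of the corner `A^{(x,y)}`. -/
noncomputable def centre (X : RectangularSpace A k) (y : Fin k) (a : A) : A :=
  a - X.cornerTrace a • X.p y

theorem centre_add (y : Fin k) (a : A) : X.centre y a + X.cornerTrace a • X.p y = a :=
  sub_add_cancel _ _

theorem IsCorner.expect_centre {x y : Fin k} {a : A} (ha : X.IsCorner x y a) :
    X.expect (X.centre y a) = 0 := by
  rw [centre, map_sub, map_smul, expect_p, ha.expect_eq', sub_self]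

theorem IsCorner.centre {x y : Fin k} {a : A} (ha : X.IsCorner x y a) :
    X.IsCorner x y (X.centre y a) := by
  rcases eq_or_ne x y with rfl | h
  · exact ha.sub_smul (isCorner_p x) _
  · rwa [RectangularSpace.centre, ha.cornerTrace_eq_zero h, zero_smul, sub_zero]

theorem centre_mem {B : Subalgebra ℂ A} (hB : X.diag ≤ B) {a : A} (ha : a ∈ B) (y : Fin k) :
    X.centre y a ∈ B :=
  sub_mem ha (B.smul_mem (hB (X.p_mem_diag y)) _)

theorem cornerTrace_eq_zero_of_expect {a : A} (h : X.expect a = 0) : X.cornerTrace a = 0 := by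
  rw [← cornerTrace_expect, h, map_zero]

variable {𝒜 : Fin 2 → Subalgebra ℂ A}

/-- Each outer letter splits into a centred part and an element of 𝒟, which F lets out. This leaves
four alternating centred words, with or without each outer letter. -/
theorem expect_alternating_eq_zero (hfree : IsFreeOver X.diag X.expect 𝒜)
    {r r' q : Fin (n + 2) → Fin k} {D C : Fin (n + 2) → A}
    (hD : ∀ i, X.IsCorner (r i) (r' i) (D i)) (hC : ∀ i, X.IsCorner (r' i) (q i) (C i))
    (hDm : ∀ i, D i ∈ 𝒜 1) (hCm : ∀ i, C i ∈ 𝒜 0) (hD0 : ∀ i, i ≠ 0 → X.expect (D i) = 0)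
    (hC0 : ∀ i, i ≠ Fin.last _ → X.expect (C i) = 0) :
    X.expect (List.ofFn fun i => D i * C i).prod = 0 := by
  rw [prod_ofFn_mul]
  set L := alternating (fun i : Fin (n + 1) => C i.castSucc) fun i => D i.succ with hLdef
  have hL : ∀ x ∈ L, x.2 ∈ 𝒜 x.1 ∧ X.expect x.2 = 0 := by
    intro x hx
    obtain ⟨i, rfl | rfl⟩ := mem_alternating hx
    · exact ⟨hCm _, hC0 _ (Fin.castSucc_lt_last i).ne⟩
    · exact ⟨hDm _, hD0 _ (Fin.succ_ne_zero i)⟩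
  have hne : L ≠ [] := by rw [hLdef, alternating_succ]; exact List.cons_ne_nil _ _
  have hch : ∀ a b, ((1, a) :: (L ++ [(0, b)])).IsChain fun x y => x.1 ≠ y.1 :=
    isChain_alternating _ _
  have h1 : ∀ a ∈ 𝒜 1, ∀ b ∈ 𝒜 0, X.expect a = 0 → X.expect b = 0 →
      X.expect (a * (L.map Prod.snd).prod * b) = 0 := by
    intro a ha b hb ha0 hb0
    have := hfree.list_prod (L := (1, a) :: (L ++ [(0, b)])) (List.cons_ne_nil _ _) ?_ (hch a b)
    · simpa [mul_assoc] using this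
    · intro x hx
      rcases List.mem_cons.1 hx with rfl | hx
      · exact ⟨ha, ha0⟩
      rcases List.mem_append.1 hx with hx | hx
      · exact hL x hx
      · obtain rfl := List.mem_singleton.1 hx
        exact ⟨hb, hb0⟩
  have h2 : ∀ a ∈ 𝒜 1, X.expect a = 0 → X.expect (a * (L.map Prod.snd).prod) = 0 := by
    intro a ha ha0
    have := hfree.list_prod (L := (1, a) :: L) (List.cons_ne_nil _ _) ?_
      ((hch a 0).prefix ⟨[(0, 0)], by simp⟩)
    · simpa using this
    · intro x hx
      rcases List.mem_cons.1 hx with rfl | hx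
      · exact ⟨ha, ha0⟩
      · exact hL x hx
  have h3 : ∀ b ∈ 𝒜 0, X.expect b = 0 → X.expect ((L.map Prod.snd).prod * b) = 0 := by
    intro b hb hb0
    have := hfree.list_prod (L := L ++ [(0, b)]) (by simp) ?_ (hch 0 b).tail
    · simpa using this
    · intro x hx
      rcases List.mem_append.1 hx with hx | hx
      · exact hL x hx
      · obtain rfl := List.mem_singleton.1 hx
        exact ⟨hb, hb0⟩
  have h4 : X.expect (L.map Prod.snd).prod = 0 :=
    hfree.list_prod hne hL ((hch 0 0).tail.prefix ⟨[(0, 0)], by simp⟩)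
  generalize (L.map Prod.snd).prod = P at *
  have hpd : ∀ (z : ℂ) y, z • X.p y ∈ X.diag := fun z y => X.diag.smul_mem (X.p_mem_diag y) z
  rw [← centre_add (X := X) (r' 0) (D 0), ← centre_add (X := X) (q (Fin.last _)) (C (Fin.last _))]
  have hDc := (hD 0).expect_centre
  have hCc := (hC (Fin.last _)).expect_centre
  have hDcm := centre_mem (hfree.1 1) (hDm 0) (r' 0)
  have hCcm := centre_mem (hfree.1 0) (hCm (Fin.last _)) (q (Fin.last _))
  rw [mul_add, add_mul, add_mul, map_add, map_add, expect_mul_diag (hpd _ _), map_add,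
    mul_assoc (_ • X.p _), expect_diag_mul (hpd _ _), expect_diag_mul (hpd _ _),
    h1 _ hDcm _ hCcm hDc hCc, h2 _ hDcm hDc, h3 _ hCcm hCc, h4]
  simp

theorem expect_mul_of_free (hfree : IsFreeOver X.diag X.expect 𝒜) {x y z : Fin k} {a b : A}
    (ha : X.IsCorner x y a) (hb : X.IsCorner y z b) (ham : a ∈ 𝒜 1) (hbm : b ∈ 𝒜 0) :
    X.expect (a * b) = X.expect a * X.expect b := by
  have h0 : X.expect (X.centre y a * X.centre z b) = 0 := by
    have := hfree.list_prod (L := [(1, X.centre y a), (0, X.centre z b)]) (List.cons_ne_nil _ _)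
      ?_ (by simp)
    · simpa using this
    · intro x hx
      simp only [List.mem_cons, List.not_mem_nil, or_false] at hx
      rcases hx with rfl | rfl
      · exact ⟨centre_mem (hfree.1 1) ham y, ha.expect_centre⟩
      · exact ⟨centre_mem (hfree.1 0) hbm z, hb.expect_centre⟩
  have hpd : ∀ (z : ℂ) y, z • X.p y ∈ X.diag := fun z y => X.diag.smul_mem (X.p_mem_diag y) z
  conv_lhs => rw [← centre_add (X := X) y a, add_mul, map_add, expect_diag_mul (hpd _ _),
    ← ha.expect_eq']
  conv_lhs => enter [1, 2, 2]; rw [← centre_add (X := X) z b]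
  rw [mul_add, map_add, h0, expect_mul_diag (hpd _ _), ha.expect_centre, zero_mul, zero_add,
    zero_add]

/-- `NC 1` is a point, so the base case is F(DC) = F(D)F(C). -/
theorem defect_one (hfree : IsFreeOver X.diag X.expect 𝒜) {r r' q : Fin 1 → Fin k}
    {D C : Fin 1 → A} (hD : ∀ i, X.IsCorner (r i) (r' i) (D i))
    (hC : ∀ i, X.IsCorner (r' i) (q i) (C i)) (hDm : ∀ i, D i ∈ 𝒜 1) (hCm : ∀ i, C i ∈ 𝒜 0) :
    X.defect D C = 0 := by
  have : Subsingleton (NC 1) := ⟨fun σ π => NC.ext_rel fun a b => by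
    obtain rfl := Subsingleton.elim a b
    exact ⟨fun _ => NC.Rel.refl _ _, fun _ => NC.Rel.refl _ _⟩⟩
  have hm : ∀ (π : NC 1) (a : Fin 1 → A), X.moment π a = X.cornerTrace (a 0) := by
    intro π a
    have hpart : ∀ i, π.1.part i = {0} := by
      intro i
      ext j
      simp only [Subsingleton.elim j i, Finset.mem_singleton, Subsingleton.elim i 0, iff_true]
      exact NC.Rel.refl π 0
    have : π.1.parts = {{0}} := by
      ext V
      rw [NC.mem_parts_iff]
      simp [hpart]
    rw [moment, this, Finset.prod_singleton, blockProd_singleton]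
  have hmix : X.mixedSum D C = X.cornerTrace (D 0) * X.cornerTrace (C 0) := by
    classical
    unfold mixedSum
    rw [Fintype.sum_subsingleton _ (NC.sep 0 0), Fintype.sum_subsingleton _ (NC.sep 0 0), hm, hm,
      ncMu_self, mul_one]
  have h := expect_mul_of_free hfree (hD 0) (hC 0) (hDm 0) (hCm 0)
  rw [(hD 0).expect_eq', (hC 0).expect_eq, smul_mul_smul_comm,
    (X.p_proj _).isIdempotentElem.eq] at h
  have h2 := cornerTrace_expect X (D 0 * C 0)
  rw [h, map_smul, cornerTrace_p, smul_eq_mul, mul_one] at h2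
  rw [defect, hmix, h2]
  simp

/-- The right label q of C is kept as a separate family because shortening reindexes q and r
differently. -/
theorem defect_eq_zero (hfree : IsFreeOver X.diag X.expect 𝒜) (n : ℕ) :
    ∀ {r r' q : Fin (n + 1) → Fin k} {D C : Fin (n + 1) → A} (_ : ∀ i, q i = r (i + 1))
    (_ : ∀ i, X.IsCorner (r i) (r' i) (D i)) (_ : ∀ i, X.IsCorner (r' i) (q i) (C i))
    (_ : ∀ i, D i ∈ 𝒜 1) (_ : ∀ i, C i ∈ 𝒜 0), X.defect D C = 0 := by
  induction n with
  | zero => exact fun _ hD hC hDm hCm => defect_one hfree hD hC hDm hCm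
  | succ n ih =>
    intro r r' q D C hq hD hC hDm hCm
    have hcontract : ∀ (B : Subalgebra ℂ A) (a : Fin (n + 2) → A) (m : Fin (n + 1)),
        (∀ i, a i ∈ B) → ∀ i, contract m a i ∈ B := by
      intro B a m ha i
      unfold contract
      split_ifs
      · exact ha _
      · exact mul_mem (ha _) (ha _)
      · exact ha _
    have hq' : ∀ (m i : Fin (n + 1)), q (m.castSucc.succAbove i) = r (m.succ.succAbove (i + 1)) :=
      fun m i => by rw [hq, succAbove_add_one]
    have hupdC : ∀ (s e : Fin (n + 2) → Fin k) (a : Fin (n + 2) → A) j u,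
        (∀ i, X.IsCorner (s i) (e i) (a i)) → X.IsCorner (s j) (e j) u →
        ∀ i, X.IsCorner (s i) (e i) (Function.update a j u i) := by
      intro s e a j u ha hu i
      rcases eq_or_ne i j with rfl | h
      · simpa using hu
      · simpa [h] using ha i
    have hupdM : ∀ (B : Subalgebra ℂ A) (a : Fin (n + 2) → A) j u,
        (∀ i, a i ∈ B) → u ∈ B → ∀ i, Function.update a j u i ∈ B := by
      intro B a j u ha hu i
      rcases eq_or_ne i j with rfl | h
      · simpa using hu
      · simpa [h] using ha i
    have hDp : ∀ D C : Fin (n + 2) → A, (∀ i, X.IsCorner (r i) (r' i) (D i)) →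
        (∀ i, X.IsCorner (r' i) (q i) (C i)) → (∀ i, D i ∈ 𝒜 1) → (∀ i, C i ∈ 𝒜 0) →
        ∀ m : Fin (n + 1), r m.succ = r' m.succ → D m.succ = X.p (r' m.succ) →
        X.defect D C = 0 := by
      intro D C hD hC hDm hCm m hm hDp
      have hmid : q m.castSucc = r' m.succ := by rw [hq, Fin.coeSucc_eq_succ, hm]
      have hE : C m.castSucc * D m.succ = C m.castSucc := by
        rw [hDp, ← hmid]
        exact (isCorner_iff.1 (hC _)).2
      rw [defect, mixedSum_erase_left hq hD hC m hm hDp, ← prod_ofFn_contract m,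
        contract_mul' m D C hE]
      exact ih (hq' m) (fun i => hD _) (isCorner_contract hC m hmid) (fun i => hDm _)
        (hcontract _ _ m hCm)
    have hCp : ∀ D C : Fin (n + 2) → A, (∀ i, X.IsCorner (r i) (r' i) (D i)) →
        (∀ i, X.IsCorner (r' i) (q i) (C i)) → (∀ i, D i ∈ 𝒜 1) → (∀ i, C i ∈ 𝒜 0) →
        ∀ m : Fin (n + 1), r' m.castSucc = q m.castSucc → C m.castSucc = X.p (q m.castSucc) →
        X.defect D C = 0 := by
      intro D C hD hC hDm hCm m hm hCp
      have hmid : r' m.castSucc = r m.succ := by rw [hm, hq, Fin.coeSucc_eq_succ]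
      have hE : D m.castSucc * C m.castSucc = D m.castSucc := by
        rw [hCp, ← hm]
        exact (isCorner_iff.1 (hD _)).2
      rw [defect, mixedSum_erase_right hq hD hC m hm hCp, ← prod_ofFn_contract m,
        contract_mul m D C hE]
      exact ih (hq' m) (isCorner_contract hD m hmid) (fun i => hC _) (hcontract _ _ m hDm)
        (fun i => hCm _)
    -- The discarded term is φ(D_j) times the defect of a word with a projection at j, zero by
    -- induction; for off-diagonal D_j already φ(D_j) = 0.
    have hDstep : ∀ D C : Fin (n + 2) → A, (∀ i, X.IsCorner (r i) (r' i) (D i)) →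
        (∀ i, X.IsCorner (r' i) (q i) (C i)) → (∀ i, D i ∈ 𝒜 1) → (∀ i, C i ∈ 𝒜 0) →
        ∀ j, j ≠ 0 → X.defect D C = X.defect (Function.update D j (X.centre (r' j) (D j))) C := by
      intro D C hD hC hDm hCm j hj
      conv_lhs => rw [← Function.update_eq_self j D, ← centre_add (X := X) (r' j) (D j),
        defect_update_left]
      rw [add_eq_left]
      by_cases h : r j = r' j
      · obtain ⟨m, rfl⟩ := Fin.exists_succ_eq.2 hj
        rw [hDp _ C (hupdC r r' D m.succ _ hD (h ▸ isCorner_p _)) hC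
          (hupdM _ D _ _ hDm (hfree.1 1 (X.p_mem_diag _))) hCm m h (by simp), mul_zero]
      · rw [(hD j).cornerTrace_eq_zero h, zero_mul]
    have hCstep : ∀ D C : Fin (n + 2) → A, (∀ i, X.IsCorner (r i) (r' i) (D i)) →
        (∀ i, X.IsCorner (r' i) (q i) (C i)) → (∀ i, D i ∈ 𝒜 1) → (∀ i, C i ∈ 𝒜 0) →
        ∀ j, j ≠ Fin.last _ →
          X.defect D C = X.defect D (Function.update C j (X.centre (q j) (C j))) := by
      intro D C hD hC hDm hCm j hj
      conv_lhs => rw [← Function.update_eq_self j C, ← centre_add (X := X) (q j) (C j),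
        defect_update_right]
      rw [add_eq_left]
      by_cases h : r' j = q j
      · obtain ⟨m, rfl⟩ := Fin.exists_castSucc_eq.2 hj
        rw [hCp D _ hD (hupdC r' q C m.castSucc _ hC (h ▸ isCorner_p _)) hDm
          (hupdM _ C _ _ hCm (hfree.1 0 (X.p_mem_diag _))) m h (by simp), mul_zero]
      · rw [(hC j).cornerTrace_eq_zero h, zero_mul]
    -- S holds the positions whose letters may still fail to be centred; induction on S centres them
    -- one at a time.
    suffices H : ∀ (S : Finset (Fin (n + 2))) (D C : Fin (n + 2) → A),
        (∀ i, X.IsCorner (r i) (r' i) (D i)) → (∀ i, X.IsCorner (r' i) (q i) (C i)) →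
        (∀ i, D i ∈ 𝒜 1) → (∀ i, C i ∈ 𝒜 0) → (∀ i, i ≠ 0 → i ∉ S → X.expect (D i) = 0) →
        (∀ i, i ≠ Fin.last _ → i ∉ S → X.expect (C i) = 0) → X.defect D C = 0 from
      H Finset.univ D C hD hC hDm hCm (fun i _ h => absurd (Finset.mem_univ i) h)
        (fun i _ h => absurd (Finset.mem_univ i) h)
    clear hD hC hDm hCm D C
    intro S
    induction S using Finset.induction_on with
    | empty =>
      intro D C hD hC hDm hCm hD0 hC0
      have hD0' := fun i hi => hD0 i hi (Finset.notMem_empty i)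
      have hC0' := fun i hi => hC0 i hi (Finset.notMem_empty i)
      rw [defect, cornerTrace_eq_zero_of_expect
          (expect_alternating_eq_zero hfree hD hC hDm hCm hD0' hC0'),
        mixedSum_eq_zero (fun i hi => cornerTrace_eq_zero_of_expect (hD0' i hi))
          (fun i hi => cornerTrace_eq_zero_of_expect (hC0' i hi)), sub_zero]
    | insert j S _ ihS =>
      intro D C hD hC hDm hCm hD0 hC0
      obtain ⟨D', hD', hDm', hD0', hDD⟩ : ∃ D' : Fin (n + 2) → A,
          (∀ i, X.IsCorner (r i) (r' i) (D' i)) ∧ (∀ i, D' i ∈ 𝒜 1) ∧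
          (∀ i, i ≠ 0 → i ∉ S → X.expect (D' i) = 0) ∧ X.defect D C = X.defect D' C := by
        by_cases hj : j = 0
        · exact ⟨D, hD, hDm, fun i hi hiS => hD0 i hi (by
            rw [Finset.mem_insert, not_or]; exact ⟨fun h => hi (h.trans hj), hiS⟩), rfl⟩
        · refine ⟨_, hupdC r r' D j _ hD (hD j).centre,
            hupdM _ D j _ hDm (centre_mem (hfree.1 1) (hDm j) _), fun i hi hiS => ?_,
            hDstep D C hD hC hDm hCm j hj⟩
          rcases eq_or_ne i j with rfl | h
          · rw [Function.update_self]
            exact (hD i).expect_centre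
          · rw [Function.update_of_ne h]
            exact hD0 i hi (by rw [Finset.mem_insert, not_or]; exact ⟨h, hiS⟩)
      obtain ⟨C', hC', hCm', hC0', hCC⟩ : ∃ C' : Fin (n + 2) → A,
          (∀ i, X.IsCorner (r' i) (q i) (C' i)) ∧ (∀ i, C' i ∈ 𝒜 0) ∧
          (∀ i, i ≠ Fin.last _ → i ∉ S → X.expect (C' i) = 0) ∧
          X.defect D' C = X.defect D' C' := by
        by_cases hj : j = Fin.last _
        · exact ⟨C, hC, hCm, fun i hi hiS => hC0 i hi (by
            rw [Finset.mem_insert, not_or]; exact ⟨fun h => hi (h.trans hj), hiS⟩), rfl⟩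
        · refine ⟨_, hupdC r' q C j _ hC (hC j).centre,
            hupdM _ C j _ hCm (centre_mem (hfree.1 0) (hCm j) _), fun i hi hiS => ?_,
            hCstep D' C hD' hC hDm' hCm j hj⟩
          rcases eq_or_ne i j with rfl | h
          · rw [Function.update_self]
            exact (hC i).expect_centre
          · rw [Function.update_of_ne h]
            exact hC0 i hi (by rw [Finset.mem_insert, not_or]; exact ⟨h, hiS⟩)
      rw [hDD, hCC]
      exact ihS D' C' hD' hC' hDm' hCm' hD0' hC0'

end RectangularSpace
end RectangularProbability

/-! ### From normalised moments to traces and weights -/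

namespace RectangularProbability
namespace RectangularSpace

variable {A : Type*} [CStarAlgebra A] [PartialOrder A] [StarOrderedRing A] [WStarAlgebra A]
  {k n : ℕ} {X : RectangularSpace A k}

/-- The normalising factors of the moment sit at the maxima of the blocks. -/
theorem moment_eq_blockTrace {s e : Fin n → Fin k} {a : Fin n → A}
    (ha : ∀ i, X.IsCorner (s i) (e i) (a i)) (π : NC n) :
    X.moment π a = (∏ i with blockPerm π i ≤ i, (X.τ (X.p (e i)))⁻¹) * X.blockTrace π a := by
  rw [← Finset.prod_fiberwise_of_maps_to (t := π.1.parts) (g := fun i => π.1.part i)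
    (fun i _ => π.part_mem_parts i), blockTrace, ← Finset.prod_mul_distrib, moment]
  refine Finset.prod_congr rfl fun V hV => ?_
  have hne := π.1.nonempty_of_mem_parts hV
  have hmax := V.max'_mem hne
  have hmin := V.min'_mem hne
  have hpart := π.1.part_eq_of_mem hV hmax
  -- Each block has a single i with π(i) ≤ i, its maximum, so each block receives one factor.
  have hfilter : ({i ∈ ({i | blockPerm π i ≤ i} : Finset (Fin n)) | π.1.part i = V}) =
      {V.max' hne} := by
    ext i
    rw [Finset.mem_singleton, Finset.mem_filter, Finset.mem_filter]
    constructor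
    · rintro ⟨⟨_, hle⟩, rfl⟩
      obtain ⟨_, h | h⟩ := NC.blockPerm_eq_iff.1 (rfl : blockPerm π i = blockPerm π i)
      · exact absurd hle h.1.not_ge
      · exact le_antisymm (Finset.le_max' _ _ (NC.Rel.refl π i)) (h.2 _ hmax).2
    · rintro rfl
      refine ⟨⟨Finset.mem_univ _, Finset.le_max' _ _ ?_⟩, hpart⟩
      have := NC.rel_blockPerm π (V.max' hne)
      rwa [NC.Rel, hpart] at this
  have hcorner : X.IsCorner (s (V.min' hne)) (e (V.max' hne)) (blockProd V a) :=
    isCorner_iff.2 ⟨mul_blockProd hmin (fun j hj => V.min'_le j hj) (isCorner_iff.1 (ha _)).1,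
      blockProd_mul hmax (fun j hj => V.le_max' j hj) (isCorner_iff.1 (ha _)).2⟩
  rw [hfilter, Finset.prod_singleton, sort_map_prod, hcorner.cornerTrace_eq']

theorem mixedSum_eq {r r' : Fin (n + 1) → Fin k} {D C : Fin (n + 1) → A}
    (hD : ∀ i, X.IsCorner (r i) (r' i) (D i)) (hC : ∀ i, X.IsCorner (r' i) (r (i + 1)) (C i)) :
    X.mixedSum D C = (∑ x ∈ compatiblePairs r r',
      X.weight r r' x.1 x.2 * X.blockTrace x.1 D * X.blockTrace (kreweras x.2) C *
        ncMu x.1 x.2) * (X.τ (X.p (r 0)))⁻¹ := by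
  classical
  -- The last index is always the maximum of its block; its factor τ(p_{r(0)})⁻¹ is the one in front
  -- of the sum, and the weight omits it through j + 1 ≠ 0.
  have hlast : ∀ π : NC (n + 1), ∏ i with blockPerm π i ≤ i, (X.τ (X.p (r (i + 1))))⁻¹ =
      (X.τ (X.p (r 0)))⁻¹ *
        ∏ j with j + 1 ≠ 0 ∧ blockPerm π j ≤ j, (X.τ (X.p (r (j + 1))))⁻¹ := by
    intro π
    have hmem : Fin.last n ∈ ({i | blockPerm π i ≤ i} : Finset (Fin (n + 1))) :=
      Finset.mem_filter.2 ⟨Finset.mem_univ _, Fin.le_last _⟩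
    rw [← Finset.mul_prod_erase _ _ hmem, Fin.last_add_one]
    congr 2
    ext j
    simp only [Finset.mem_erase, Finset.mem_filter, Finset.mem_univ, true_and]
    refine and_congr_left fun _ => not_congr ?_
    rw [← Fin.last_add_one n, add_left_inj]
  unfold mixedSum
  rw [← Fintype.sum_prod_type' (f := fun σ π =>
      X.moment σ D * X.moment (kreweras π) C * ncMu σ π),
    ← Finset.sum_subset (Finset.subset_univ (compatiblePairs r r')), Finset.sum_mul]
  · refine Finset.sum_congr rfl fun x _ => ?_
    rw [moment_eq_blockTrace hD, moment_eq_blockTrace hC, hlast, weight]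
    ring
  -- A pair outside `compatiblePairs` has mismatched labels, which kill a moment, or σ ≰ π, which
  -- kills μ.
  · rintro ⟨σ, π⟩ _ hx
    by_contra hne
    have h1 := left_ne_zero_of_mul hne
    have h2 := eq_of_moment_ne_zero hD (left_ne_zero_of_mul h1)
    have h3 := eq_of_moment_ne_zero (e := fun i => r (i + 1)) hC (right_ne_zero_of_mul h1)
    refine hx (Finset.mem_filter.2 ⟨Finset.mem_univ _, ?_, fun i => ⟨h2 i, ?_⟩⟩)
    · by_contra h
      exact hne (by rw [ncMu_eq_zero h, mul_zero])
    · simpa using h3 (i - 1)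

end RectangularSpace
end RectangularProbability


theorem proposition5p1 {A : Type*} [CStarAlgebra A] [PartialOrder A] [StarOrderedRing A]
    [WStarAlgebra A] {k : ℕ} (X : RectangularSpace A k)
    {s t : ℕ} (c : Fin s → A) (d : Fin t → A)
    (hc : ∀ i, X.IsSimple (c i)) (hd : ∀ i, X.IsSimple (d i))
    (hfree : IsFreeOver X.diag X.expect
      ![X.algebraGenerated (Set.range c), X.algebraGenerated (Set.range d)])
    {n : ℕ} [NeZero n] (r r' : Fin n → Fin k) (D C : Fin n → A)
    (hD : ∀ j, D j ∈ Submonoid.closure (Set.range d))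
    (hC : ∀ j, C j ∈ Submonoid.closure (Set.range c))
    (hDr : ∀ j, X.IsCorner (r j) (r' j) (D j))
    (hCr : ∀ j, X.IsCorner (r' j) (r (j + 1)) (C j)) :
    X.expect (List.ofFn fun j => D j * C j).prod =
      (∑ x ∈ compatiblePairs r r',
        X.weight r r' x.1 x.2 * X.blockTrace x.1 D * X.blockTrace (kreweras x.2) C *
          ncMu x.1 x.2) •
        ((X.τ (X.p (r 0)))⁻¹ • X.p (r 0)) := by
  obtain ⟨n, rfl⟩ := Nat.exists_eq_succ_of_ne_zero (NeZero.ne n)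
  have hcl : ∀ (s : Set A) a, a ∈ Submonoid.closure s → a ∈ X.algebraGenerated s := fun s a ha =>
    Submonoid.closure_le (S := (X.algebraGenerated s).toSubmonoid).2
      (fun _ hx => Algebra.subset_adjoin (Or.inl hx)) ha
  have hcorner : X.IsCorner (r 0) (r (Fin.last n + 1)) (List.ofFn fun j => D j * C j).prod := by
    have hDC := fun j => (hDr j).mul (hCr j)
    rw [← blockProd_univ, RectangularSpace.isCorner_iff]
    exact ⟨mul_blockProd (Finset.mem_univ 0) (fun j _ => Fin.zero_le j)
        (RectangularSpace.isCorner_iff.1 (hDC 0)).1,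
      blockProd_mul (Finset.mem_univ (Fin.last n)) (fun j _ => Fin.le_last j)
        (RectangularSpace.isCorner_iff.1 (hDC (Fin.last n))).2⟩
  have h := RectangularSpace.defect_eq_zero hfree n (q := fun i => r (i + 1)) (fun _ => rfl) hDr hCr
    (fun i => hcl _ _ (hD i)) (fun i => hcl _ _ (hC i))
  rw [hcorner.expect_eq, sub_eq_zero.1 h, RectangularSpace.mixedSum_eq hDr hCr, mul_smul]
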